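/- Let $\mathbb N$ denote the positive integers and $\mathbb N_0=\mathbb N\cup\{0\}$. For $n\in\mathbb N$ let $\lambda(n)$ and $\mu(n)$ be the least and the greatest exponent occurring in $n$ written in base $2$. A set $X\subseteq\mathbb N$ is \emph{apart} (that is, $2$-apart) if $\mu(x)<\lambda(x')$ for all $x<x'$ in $X$. Consider the following two principles of second-order arithmetic. ($\mathsf{HT}^{\le 2}_2$ with apartness) For every $f:\mathbb N\to\{0,1\}$ there is an infinite apart set $H\subseteq\mathbb N$ such that $f$ is constant on $\{x : x\in H\}\cup\{x+y : x,y\in H,\ x\ne y\}$. ($\mathsf{FUT}^{\le 2}_2$) For every colouring $f$ of the finite subsets of $\mathbb N_0$ with colours $0,1$ there is an infinite sequence $(X_i)_{i\in\mathbb N}$ of non-empty finite subsets of $\mathbb N$ with $\max X_i<\min X_j$ for all $i<j$ such that $f$ is constant on $\{X_i : i\in\mathbb N\}\cup\{X_i\cup X_j : i\neq j\}$. (Finite subsets of $\mathbb N_0$ are coded by numbers in the usual way, $D$ having the code $\sum_{e\in D}2^e$.) Then, over $\mathsf{RCA}_0$, $\mathsf{HT}^{\le 2}_2$ with apartness is equivalent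 to $\mathsf{FUT}^{\le 2}_2$, and each of them implies $\mathsf{ACA}_0$. That is, in every model $(M,\mathcal S)$ of $\mathsf{RCA}_0$ (with $M$ not necessarily the standard numbers and $\mathcal S$ the sets of the model) one of the two principles holds if and only if the other does, and if they hold then $(M,\mathcal S)$ is a model of $\mathsf{ACA}_0$. -/

import Mathlib

universe u

namespace SOA

/-! ## The language of second-order arithmetic

A structure for this language consists of a type `M` of numbers with `0`, `1`, `+`, `·`, `<` and a
non-empty family `S : Set (Set M)` over which the set variables range.  `M` need not be the
standard natural numbers and `S` need not be the full power set. -/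

/-- Number terms; the number variables are indexed by `ℕ`. -/
inductive NumTerm : Type
  | var (x : ℕ) : NumTerm
  | zero : NumTerm
  | one : NumTerm
  | add (s t : NumTerm) : NumTerm
  | mul (s t : NumTerm) : NumTerm

/-- The number variables that occur in a term. -/
def NumTerm.vars : NumTerm → Set ℕ
  | var x => {x}
  | zero => ∅
  | one => ∅
  | add s t => s.vars ∪ t.vars
  | mul s t => s.vars ∪ t.vars

/-- Arithmetical formulas: number quantifiers only; set variables (indexed by `ℕ`) may occur
free, as parameters. -/
inductive ArithFormula : Type
  | eq (s t : NumTerm) : ArithFormula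
  | lt (s t : NumTerm) : ArithFormula
  | mem (t : NumTerm) (X : ℕ) : ArithFormula
  | neg (φ : ArithFormula) : ArithFormula
  | and (φ ψ : ArithFormula) : ArithFormula
  | or (φ ψ : ArithFormula) : ArithFormula
  | imp (φ ψ : ArithFormula) : ArithFormula
  | all (x : ℕ) (φ : ArithFormula) : ArithFormula
  | ex (x : ℕ) (φ : ArithFormula) : ArithFormula

/-- Bounded-quantifier formulas: all quantifiers are of the form `∀ x < t` or `∃ x < t`,
where `x` does not occur in the term `t`. -/
inductive IsBounded : ArithFormula → Prop
  | eq (s t : NumTerm) : IsBounded (.eq s t)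
  | lt (s t : NumTerm) : IsBounded (.lt s t)
  | mem (t : NumTerm) (X : ℕ) : IsBounded (.mem t X)
  | neg {φ : ArithFormula} : IsBounded φ → IsBounded (.neg φ)
  | and {φ ψ : ArithFormula} : IsBounded φ → IsBounded ψ → IsBounded (.and φ ψ)
  | or {φ ψ : ArithFormula} : IsBounded φ → IsBounded ψ → IsBounded (.or φ ψ)
  | imp {φ ψ : ArithFormula} : IsBounded φ → IsBounded ψ → IsBounded (.imp φ ψ)
  | ball {x : ℕ} {t : NumTerm} {φ : ArithFormula} : x ∉ t.vars → IsBounded φ →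
      IsBounded (.all x (.imp (.lt (.var x) t) φ))
  | bex {x : ℕ} {t : NumTerm} {φ : ArithFormula} : x ∉ t.vars → IsBounded φ →
      IsBounded (.ex x (.and (.lt (.var x) t) φ))

/-- `Σ⁰₁` formulas: `∃ x θ` with `θ` a bounded-quantifier formula. -/
def IsSigma01 (φ : ArithFormula) : Prop := ∃ x θ, IsBounded θ ∧ φ = .ex x θ

/-- `Π⁰₁` formulas: `∀ x θ` with `θ` a bounded-quantifier formula. -/
def IsPi01 (φ : ArithFormula) : Prop := ∃ x θ, IsBounded θ ∧ φ = .all x θ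

section Semantics

variable {M : Type u} [Zero M] [One M] [Add M] [Mul M] [LT M]

/-- The value of a term under an assignment `v` of numbers to the number variables. -/
def NumTerm.eval (v : ℕ → M) : NumTerm → M
  | var x => v x
  | zero => 0
  | one => 1
  | add s t => s.eval v + t.eval v
  | mul s t => s.eval v * t.eval v

/-- Tarskian satisfaction of an arithmetical formula under an assignment `v` of numbers and an
assignment `V` of sets to the variables. -/
def Sat (V : ℕ → Set M) : ArithFormula → (ℕ → M) → Prop
  | .eq s t, v => s.eval v = t.eval v
  | .lt s t, v => s.eval v < t.eval v
  | .mem t X, v => t.eval v ∈ V X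
  | .neg φ, v => ¬ Sat V φ v
  | .and φ ψ, v => Sat V φ v ∧ Sat V ψ v
  | .or φ ψ, v => Sat V φ v ∨ Sat V ψ v
  | .imp φ ψ, v => Sat V φ v → Sat V ψ v
  | .all x φ, v => ∀ a : M, Sat V φ (Function.update v x a)
  | .ex x φ, v => ∃ a : M, Sat V φ (Function.update v x a)

/-! ## The axiom systems -/

variable (M) in
/-- The basic axioms of second-order arithmetic. -/
structure BasicAxioms : Prop where
  succ_ne_zero : ∀ n : M, n + 1 ≠ 0
  succ_inj : ∀ m n : M, m + 1 = n + 1 → m = n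
  add_zero : ∀ m : M, m + 0 = m
  add_succ : ∀ m n : M, m + (n + 1) = (m + n) + 1
  mul_zero : ∀ m : M, m * 0 = 0
  mul_succ : ∀ m n : M, m * (n + 1) = m * n + m
  not_lt_zero : ∀ m : M, ¬ m < 0
  lt_succ : ∀ m n : M, m < n + 1 ↔ m < n ∨ m = n

/-- `(M, S)` is a model of `RCA₀`: basic axioms, `Σ⁰₁` induction and `Δ⁰₁` comprehension, the
schemes with arbitrary number parameters from `M` and set parameters from `S`. -/
structure RCA0 (S : Set (Set M)) : Prop where
  /-- the range of the set variables is non-empty -/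
  nonempty : S.Nonempty
  basic : BasicAxioms M
  sigma01_induction : ∀ (φ : ArithFormula), IsSigma01 φ →
    ∀ (x : ℕ) (v : ℕ → M) (V : ℕ → Set M), (∀ i, V i ∈ S) →
      Sat V φ (Function.update v x 0) →
      (∀ a : M, Sat V φ (Function.update v x a) → Sat V φ (Function.update v x (a + 1))) →
      ∀ a : M, Sat V φ (Function.update v x a)
  delta01_comprehension : ∀ (φ ψ : ArithFormula), IsSigma01 φ → IsPi01 ψ →
    ∀ (x : ℕ) (v : ℕ → M) (V : ℕ → Set M), (∀ i, V i ∈ S) →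
      (∀ a : M, Sat V φ (Function.update v x a) ↔ Sat V ψ (Function.update v x a)) →
      ∃ X ∈ S, ∀ a : M, a ∈ X ↔ Sat V φ (Function.update v x a)

/-- `(M, S)` is a model of `ACA₀`: basic axioms, the induction axiom and arithmetical
comprehension. -/
structure ACA0 (S : Set (Set M)) : Prop where
  /-- the range of the set variables is non-empty -/
  nonempty : S.Nonempty
  basic : BasicAxioms M
  induction : ∀ X ∈ S, (0 : M) ∈ X → (∀ a ∈ X, a + 1 ∈ X) → ∀ a : M, a ∈ X
  arithmetical_comprehension : ∀ (φ : ArithFormula)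
    (x : ℕ) (v : ℕ → M) (V : ℕ → Set M), (∀ i, V i ∈ S) →
      ∃ X ∈ S, ∀ a : M, a ∈ X ↔ Sat V φ (Function.update v x a)

/-! ## Functions, powers of two, finite sets

Everything below is relative to a structure `(M, S)`: numbers are elements of `M`, and all
set quantifiers range over `S`. -/

/-- The usual code of an ordered pair, `(i, j) = (i + j)² + i`. -/
def pair (i j : M) : M := (i + j) * (i + j) + i

/-- `F` is (the set of pairs coding) a function from `A` to `B`. -/
def IsFun (F A B : Set M) : Prop :=
  (∀ z ∈ F, ∃ x ∈ A, ∃ y ∈ B, z = pair x y) ∧ ∀ x ∈ A, ∃! y, pair x y ∈ F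

/-- `p = 2 ^ e`: `p` is the value at `e` of the function defined by the primitive recursion
`g 0 = 1`, `g (i + 1) = 2 * g i`. -/
def IsPow2 (S : Set (Set M)) (e p : M) : Prop :=
  ∃ G ∈ S, IsFun G Set.univ Set.univ ∧ pair 0 1 ∈ G ∧
    (∀ i y, pair i y ∈ G → pair (i + 1) ((1 + 1) * y) ∈ G) ∧ pair e p ∈ G

/-- `e` is one of the exponents of `n` written in base `2`, that is, `n = (2 q + 1) 2 ^ e + r` with
`r < 2 ^ e`.  This is also the membership relation `e ∈ Dₙ` of the usual coding of finite sets of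
numbers (including `0`) by numbers, where `n = ∑_{e ∈ Dₙ} 2 ^ e` is the code of `Dₙ`. -/
def HasExponent (S : Set (Set M)) (n e : M) : Prop :=
  ∃ p q r : M, IsPow2 S e p ∧ r < p ∧ n = ((1 + 1) * q + 1) * p + r

/-- `e = λ(n)`, the least exponent of `n` in base `2`; equally, `e = min Dₙ`. -/
def IsLeastExponent (S : Set (Set M)) (n e : M) : Prop :=
  HasExponent S n e ∧ ∀ d, HasExponent S n d → e < d ∨ e = d

/-- `e = μ(n)`, the greatest exponent of `n` in base `2`; equally, `e = max Dₙ`. -/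
def IsGreatestExponent (S : Set (Set M)) (n e : M) : Prop :=
  HasExponent S n e ∧ ∀ d, HasExponent S n d → d < e ∨ d = e

/-- `μ(m) < λ(n)`; equally, `max D_m < min D_n`. -/
def Before (S : Set (Set M)) (m n : M) : Prop :=
  ∃ a b, IsGreatestExponent S m a ∧ IsLeastExponent S n b ∧ a < b

/-! ## The combinatorial principles -/

variable (M) in
/-- The positive integers of the model. -/
def Pos : Set M := {a | 0 < a}

variable (M) in
/-- The two colours `0` and `1`. -/
def Two : Set M := {a | a < 1 + 1}

/-- The non-empty sums of at most two distinct elements of `H`. -/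
def FSle2 (H : Set M) : Set M :=
  {z | z ∈ H ∨ ∃ x ∈ H, ∃ y ∈ H, x ≠ y ∧ z = x + y}

/-- The `2`-apartness condition: `μ(x) < λ(x')` whenever `x < x'` are in `H`. -/
def IsApart (S : Set (Set M)) (H : Set M) : Prop :=
  ∀ x ∈ H, ∀ x' ∈ H, x < x' → Before S x x'

/-- Hindman's theorem for sums of at most two elements and two colours, with `2`-apartness: for
every `2`-colouring of the positive integers there is an infinite `2`-apart set `H` of positive
integers such that all sums of one or two distinct elements of `H` have the same colour. -/
def HT22Apart (S : Set (Set M)) : Prop :=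
  ∀ F ∈ S, IsFun F (Pos M) (Two M) →
    ∃ H ∈ S, H ⊆ Pos M ∧ (∀ a : M, ∃ x ∈ H, a < x) ∧ IsApart S H ∧
      ∃ c ∈ Two M, ∀ z ∈ FSle2 H, pair z c ∈ F

/-- `D_u = D_m ∪ D_n`. -/
def IsUnion (S : Set (Set M)) (m n u : M) : Prop :=
  ∀ e, HasExponent S u e ↔ HasExponent S m e ∨ HasExponent S n e

/-- The (codes of) unions of one or two members of the sequence `X` of (codes of) finite sets. -/
def FUle2 (S : Set (Set M)) (X : Set M) : Set M :=
  {z | (∃ i ∈ Pos M, pair i z ∈ X) ∨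
    ∃ i ∈ Pos M, ∃ j ∈ Pos M, i ≠ j ∧
      ∃ m n, pair i m ∈ X ∧ pair j n ∈ X ∧ IsUnion S m n z}

/-- The finite unions theorem for unions of at most two sets and two colours: for every
`2`-colouring of the finite sets of non-negative integers there is an infinite sequence
`X₁, X₂, …` of non-empty finite sets of positive integers with `max Xᵢ < min Xⱼ` for `i < j` such
that all unions of one or two members of the sequence have the same colour. -/
def FUT22 (S : Set (Set M)) : Prop :=
  ∀ F ∈ S, IsFun F Set.univ (Two M) →
    ∃ X ∈ S, IsFun X (Pos M) Set.univ ∧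
      (∀ i m, pair i m ∈ X →
        (∃ e, HasExponent S m e) ∧ ∀ e, HasExponent S m e → e ∈ Pos M) ∧
      (∀ i j m n, i < j → pair i m ∈ X → pair j n ∈ X → Before S m n) ∧
      ∃ c ∈ Two M, ∀ z ∈ FUle2 S X, pair z c ∈ F

end Semantics

end SOA

-- For the equivalence, a positive number is the code of a non-empty finite set, and `Before` means
-- the same for numbers and for sets. If `Before S m n`, adding m and n produces no carry, so m + n
-- is the code of the union (`Before.isUnion`); since a number is determined by its exponents
-- (`eq_of_hasExponent_iff`), sums and unions of two members are the same objects. An apart set H is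
-- turned into a sequence by enumerating it in increasing order, and a sequence of sets into its
-- range.
--
-- For `ACA0` it suffices to form the set of all x with ∃ s, T x s, where T is in the model and each
-- x has at most one stage s; the least-witness relation reduces Σ⁰₁ comprehension to this case, and
-- quantifiers are then eliminated one at a time. Call two consecutive exponents a < b of n an
-- important gap if some x < λ(n) is enumerated at a stage s with a ≤ s < b. Colour n by the parity
-- of its number of important gaps, and let H be apart and homogeneous for sums of at most two
-- elements.
--
-- Claim: if n ∈ H, x < λ(n) and T x s, then s < n. Otherwise s ≥ μ(n). By strong Σ⁰₁ bounding there
-- is m ∈ H whose λ(m) exceeds s and all stages of numbers below μ(n). The important gaps of n + m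
-- are then those of n, the new gap from μ(n) to λ(m), which is important because of x, and no gap
-- above it. So n and n + m have different parities, against homogeneity. By the claim, x is
-- enumerated iff it is enumerated before n, for any n ∈ H with λ(n) > x; choosing n existentially
-- or universally makes this Δ⁰₁ in H.
--
-- All of this takes place in a possibly nonstandard model, so the file first derives the ordered
-- semiring, coding of finite sets, primitive recursion and binary expansions from the axioms. The
-- classes `D0` and `DF` let instance search verify that the relations and functions in use are
-- coded by sets of the model.

namespace SOA

/-! ## Comprehension and induction for explicit bounded formulas -/

section Raw

variable {M : Type u} [Zero M] [One M] [Add M] [Mul M] [LT M] {S : Set (Set M)}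

/-- The term for the pair `(i, j)`. -/
def NumTerm.pair (s t : NumTerm) : NumTerm := .add (.mul (.add s t) (.add s t)) s

omit [LT M] in
theorem NumTerm.eval_pair (v : ℕ → M) (s t : NumTerm) :
    (NumTerm.pair s t).eval v = SOA.pair (s.eval v) (t.eval v) := rfl

/-- A dummy quantifier over variable 1 makes a bounded formula both Σ⁰₁ and Π⁰₁; for this reason `h`
asks for the same truth value at every b. Variable 0 carries the element. -/
theorem RCA0.bounded_comprehension (hS : RCA0 S) {θ : ArithFormula} (hθ : IsBounded θ) (v : ℕ → M)
    (V : ℕ → Set M) (hV : ∀ i, V i ∈ S) (P : M → Prop)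
    (h : ∀ a b, Sat V θ (Function.update (Function.update v 0 a) 1 b) ↔ P a) : {a | P a} ∈ S := by
  obtain ⟨X, hX, hXs⟩ := hS.delta01_comprehension (.ex 1 θ) (.all 1 θ) ⟨1, θ, hθ, rfl⟩
    ⟨1, θ, hθ, rfl⟩ 0 v V hV (fun a => by
      simp only [Sat, h]; exact ⟨fun ⟨_, h⟩ _ => h, fun h => ⟨0, h 0⟩⟩)
  convert hX
  ext a
  simp only [hXs, Sat, h]
  exact ⟨fun h => ⟨0, h⟩, fun ⟨_, h⟩ => h⟩

theorem RCA0.set_induction (hS : RCA0 S) {P : M → Prop} (hP : {a | P a} ∈ S) (h0 : P 0)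
    (hs : ∀ a, P a → P (a + 1)) (a : M) : P a := by
  have := hS.sigma01_induction (.ex 1 (.mem (.var 0) 0)) ⟨1, _, .mem _ _, rfl⟩ 0 (fun _ => 0)
    (fun _ => {a | P a}) (fun _ => hP)
  simp only [Sat, NumTerm.eval, Function.update_apply, Set.mem_ofPred_eq] at this
  obtain ⟨_, h⟩ := this ⟨0, by simpa using h0⟩ (fun a ⟨_, h⟩ => ⟨0, by simpa using hs a (by simpa using h)⟩) a
  simpa using h

theorem RCA0.bounded_induction (hS : RCA0 S) {θ : ArithFormula} (hθ : IsBounded θ) (v : ℕ → M)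
    (P : M → Prop)
    (h : ∀ V : ℕ → Set M, ∀ a b, Sat V θ (Function.update (Function.update v 0 a) 1 b) ↔ P a)
    (h0 : P 0) (hs : ∀ a, P a → P (a + 1)) (a : M) : P a :=
  hS.set_induction (hS.bounded_comprehension hθ v (fun _ => hS.nonempty.some)
    (fun _ => hS.nonempty.some_mem) P (h _)) h0 hs a

/-! ## The ordered semiring of numbers -/

/-- The assignment of `a, b, c` to the variables `2, 3, 4`. -/
def assign (a b c : M) : ℕ → M
  | 2 => a
  | 3 => b
  | 4 => c
  | _ => 0

theorem RCA0.eq_induction (hS : RCA0 S) (s t : NumTerm) (x y z : M) {f g : M → M}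
    (hf : ∀ a b, s.eval (Function.update (Function.update (assign x y z) 0 a) 1 b) = f a)
    (hg : ∀ a b, t.eval (Function.update (Function.update (assign x y z) 0 a) 1 b) = g a)
    (h0 : f 0 = g 0) (hs : ∀ a, f a = g a → f (a + 1) = g (a + 1)) (a : M) : f a = g a :=
  hS.bounded_induction (.eq s t) (assign x y z) (fun a => f a = g a)
    (fun V a b => by simp only [Sat, hf, hg]) h0 hs a

open NumTerm in
theorem RCA0.zero_add (hS : RCA0 S) (a : M) : 0 + a = a :=
  hS.eq_induction (f := fun a => 0 + a) (g := fun a => a)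
    (add zero (var 0)) (var 0) 0 0 0 (fun _ _ => rfl) (fun _ _ => rfl)
    (hS.basic.add_zero 0) (fun a h => by rw [hS.basic.add_succ, h]) a

open NumTerm in
theorem RCA0.succ_add (hS : RCA0 S) (x a : M) : x + 1 + a = x + a + 1 :=
  hS.eq_induction (f := fun a => x + 1 + a) (g := fun a => x + a + 1)
    (add (add (var 2) one) (var 0)) (add (add (var 2) (var 0)) one) x 0 0
    (fun _ _ => rfl) (fun _ _ => rfl) (by simp only [hS.basic.add_zero])
    (fun a h => by simp only [hS.basic.add_succ, h]) a

open NumTerm in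
theorem RCA0.add_comm (hS : RCA0 S) (x a : M) : x + a = a + x :=
  hS.eq_induction (f := fun a => x + a) (g := fun a => a + x)
    (add (var 2) (var 0)) (add (var 0) (var 2)) x 0 0
    (fun _ _ => rfl) (fun _ _ => rfl) (by simp only [hS.basic.add_zero, hS.zero_add])
    (fun a h => by simp only [hS.basic.add_succ, hS.succ_add, h]) a

open NumTerm in
theorem RCA0.add_assoc (hS : RCA0 S) (x y a : M) : x + y + a = x + (y + a) :=
  hS.eq_induction (f := fun a => x + y + a) (g := fun a => x + (y + a))
    (add (add (var 2) (var 3)) (var 0)) (add (var 2) (add (var 3) (var 0))) x y 0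
    (fun _ _ => rfl) (fun _ _ => rfl) (by simp only [hS.basic.add_zero])
    (fun a h => by simp only [hS.basic.add_succ, h]) a

open NumTerm in
theorem RCA0.zero_mul (hS : RCA0 S) (a : M) : 0 * a = 0 :=
  hS.eq_induction (f := fun a => 0 * a) (g := fun a => 0)
    (mul zero (var 0)) zero 0 0 0 (fun _ _ => rfl) (fun _ _ => rfl)
    (hS.basic.mul_zero 0) (fun a h => by rw [hS.basic.mul_succ, h, hS.basic.add_zero]) a

open NumTerm in
theorem RCA0.mul_add (hS : RCA0 S) (x y a : M) : x * (y + a) = x * y + x * a :=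
  hS.eq_induction (f := fun a => x * (y + a)) (g := fun a => x * y + x * a)
    (mul (var 2) (add (var 3) (var 0)))
    (add (mul (var 2) (var 3)) (mul (var 2) (var 0))) x y 0
    (fun _ _ => rfl) (fun _ _ => rfl) (by simp only [hS.basic.add_zero, hS.basic.mul_zero])
    (fun a h => by simp only [hS.basic.add_succ, hS.basic.mul_succ, h]; rw [hS.add_assoc]) a

open NumTerm in
theorem RCA0.succ_mul (hS : RCA0 S) (x a : M) : (x + 1) * a = x * a + a :=
  hS.eq_induction (f := fun a => (x + 1) * a) (g := fun a => x * a + a)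
    (mul (add (var 2) one) (var 0)) (add (mul (var 2) (var 0)) (var 0)) x 0 0
    (fun _ _ => rfl) (fun _ _ => rfl) (by simp only [hS.basic.add_zero, hS.basic.mul_zero])
    (fun a h => by
      simp only [hS.basic.mul_succ, h, hS.basic.add_succ]
      rw [hS.add_assoc, hS.add_assoc, hS.basic.add_succ, hS.basic.add_succ, hS.add_comm a x,
        ← hS.add_assoc]) a

open NumTerm in
theorem RCA0.mul_comm (hS : RCA0 S) (x a : M) : x * a = a * x :=
  hS.eq_induction (f := fun a => x * a) (g := fun a => a * x)
    (mul (var 2) (var 0)) (mul (var 0) (var 2)) x 0 0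
    (fun _ _ => rfl) (fun _ _ => rfl) (by simp only [hS.basic.mul_zero, hS.zero_mul])
    (fun a h => by simp only [hS.basic.mul_succ, hS.succ_mul, h]) a

open NumTerm in
theorem RCA0.mul_assoc (hS : RCA0 S) (x y a : M) : x * y * a = x * (y * a) :=
  hS.eq_induction (f := fun a => x * y * a) (g := fun a => x * (y * a))
    (mul (mul (var 2) (var 3)) (var 0)) (mul (var 2) (mul (var 3) (var 0))) x y 0
    (fun _ _ => rfl) (fun _ _ => rfl) (by simp only [hS.basic.mul_zero])
    (fun a h => by simp only [hS.basic.mul_succ, h, hS.mul_add]) a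

/-- The commutative semiring of numbers. -/
abbrev RCA0.commSemiring (hS : RCA0 S) : CommSemiring M where
  add_assoc := hS.add_assoc
  zero_add := hS.zero_add
  add_zero := hS.basic.add_zero
  add_comm := hS.add_comm
  left_distrib := hS.mul_add
  right_distrib a b c := by rw [hS.mul_comm, hS.mul_add, hS.mul_comm c, hS.mul_comm c]
  zero_mul := hS.zero_mul
  mul_zero := hS.basic.mul_zero
  mul_assoc := hS.mul_assoc
  one_mul a := by
    have := hS.succ_mul 0 a
    rwa [hS.zero_add, hS.zero_mul, hS.zero_add] at this
  mul_one a := by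
    have := hS.basic.mul_succ a 0
    rwa [hS.zero_add, hS.basic.mul_zero, hS.zero_add] at this
  mul_comm := hS.mul_comm
  nsmul := nsmulRec
  npow := fun n x => npowRec n x

theorem RCA0.lt_succ_self (hS : RCA0 S) (a : M) : a < a + 1 :=
  (hS.basic.lt_succ a a).2 (.inr rfl)

open ArithFormula NumTerm in
theorem RCA0.eq_zero_or_pos (hS : RCA0 S) (a : M) : 0 = a ∨ 0 < a :=
  hS.bounded_induction (.or (.eq zero (var 0)) (.lt zero (var 0))) (assign 0 0 0)
    (fun a => 0 = a ∨ 0 < a) (fun _ _ _ => Iff.rfl) (.inl rfl)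
    (fun _ h => .inr ((hS.basic.lt_succ _ _).2 h.symm)) a

open ArithFormula NumTerm in
theorem RCA0.lt_trans (hS : RCA0 S) {x y : M} (hxy : x < y) (a : M) : y < a → x < a :=
  hS.bounded_induction (.imp (.lt (var 3) (var 0)) (.lt (var 2) (var 0))) (assign x y 0)
    (fun a => y < a → x < a) (fun _ _ _ => Iff.rfl) (fun h => (hS.basic.not_lt_zero _ h).elim)
    (fun a h h' => (hS.basic.lt_succ _ _).2 (.inl (by
      rcases (hS.basic.lt_succ _ _).1 h' with h' | rfl
      exacts [h h', hxy]))) a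

open ArithFormula NumTerm in
theorem RCA0.lt_irrefl (hS : RCA0 S) (a : M) : ¬ a < a :=
  hS.bounded_induction (.neg (.lt (var 0) (var 0))) (assign 0 0 0)
    (fun a => ¬ a < a) (fun _ _ _ => Iff.rfl) (hS.basic.not_lt_zero _)
    (fun a h h' => by
      rcases (hS.basic.lt_succ _ _).1 h' with h' | h'
      · exact h (hS.lt_trans (hS.lt_succ_self a) a h')
      · have := hS.lt_succ_self a
        rw [h'] at this
        exact h this) a

open ArithFormula NumTerm in
theorem RCA0.succ_lt_succ (hS : RCA0 S) (x a : M) : x < a → x + 1 < a + 1 :=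
  hS.bounded_induction (.imp (.lt (var 2) (var 0)) (.lt (add (var 2) one) (add (var 0) one)))
    (assign x 0 0)
    (fun a => x < a → x + 1 < a + 1) (fun _ _ _ => Iff.rfl)
    (fun h => (hS.basic.not_lt_zero _ h).elim)
    (fun a h h' => by
      rcases (hS.basic.lt_succ _ _).1 h' with h' | rfl
      exacts [hS.lt_trans (h h') _ (hS.lt_succ_self _), hS.lt_succ_self _]) a

open ArithFormula NumTerm in
theorem RCA0.lt_trichotomy (hS : RCA0 S) (x a : M) : a < x ∨ a = x ∨ x < a :=
  hS.bounded_induction (.or (.lt (var 0) (var 2)) (.or (.eq (var 0) (var 2)) (.lt (var 2) (var 0))))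
    (assign x 0 0)
    (fun a => a < x ∨ a = x ∨ x < a) (fun _ _ _ => Iff.rfl)
    ((hS.eq_zero_or_pos x).elim (fun h => .inr (.inl h)) .inl)
    (fun a h => by
      rcases h with h | rfl | h
      · rcases (hS.basic.lt_succ _ _).1 (hS.succ_lt_succ _ _ h) with h | h
        exacts [.inl h, .inr (.inl h)]
      · exact .inr (.inr (hS.lt_succ_self _))
      · exact .inr (.inr (hS.lt_trans h _ (hS.lt_succ_self _)))) a

open ArithFormula NumTerm in
-- The bound c < a is there to keep the induction formula bounded; `RCA0.lt_iff_exists` drops it.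
theorem RCA0.exists_of_lt (hS : RCA0 S) (x a : M) : x < a → ∃ c, c < a ∧ a = x + c + 1 :=
  hS.bounded_induction (.imp (.lt (var 2) (var 0))
      (.bex (x := 5) (t := var 0) (by simp [vars]) (.eq (var 0) (add (add (var 2) (var 5)) one))))
    (assign x 0 0)
    (fun a => x < a → ∃ c, c < a ∧ a = x + c + 1) (fun _ _ _ => Iff.rfl)
    (fun h => (hS.basic.not_lt_zero _ h).elim)
    (fun a h h' => by
      rcases (hS.basic.lt_succ _ _).1 h' with h' | rfl
      · obtain ⟨c, hc, rfl⟩ := h h'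
        exact ⟨c + 1, hS.succ_lt_succ _ _ hc, by rw [hS.basic.add_succ]⟩
      · refine ⟨0, (hS.basic.lt_succ _ _).2 (hS.eq_zero_or_pos x).symm, ?_⟩
        rw [hS.basic.add_zero]) a

open ArithFormula NumTerm in
theorem RCA0.lt_add_succ (hS : RCA0 S) (x a : M) : x < x + a + 1 :=
  hS.bounded_induction (.lt (var 2) (add (add (var 2) (var 0)) one)) (assign x 0 0)
    (fun a => x < x + a + 1) (fun _ _ _ => Iff.rfl)
    (by rw [hS.basic.add_zero]; exact hS.lt_succ_self x)
    (fun a h => by rw [hS.basic.add_succ]; exact hS.lt_trans h _ (hS.lt_succ_self _)) a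

theorem RCA0.lt_iff_exists (hS : RCA0 S) (x y : M) : x < y ↔ ∃ c, y = x + c + 1 :=
  ⟨fun h => let ⟨c, _, h⟩ := hS.exists_of_lt x y h; ⟨c, h⟩,
    fun ⟨c, h⟩ => h ▸ hS.lt_add_succ x c⟩

open Classical in
/-- The linear order of numbers. -/
noncomputable abbrev RCA0.linearOrder (hS : RCA0 S) : LinearOrder M where
  le a b := a < b ∨ a = b
  lt := (· < ·)
  le_refl _ := .inr rfl
  le_trans a b c := by
    rintro (h | rfl) (h' | rfl)
    exacts [.inl (hS.lt_trans h _ h'), .inl h, .inl h', .inr rfl]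
  lt_iff_le_not_ge a b := by
    refine ⟨fun h => ⟨.inl h, ?_⟩, fun ⟨h, h'⟩ => ?_⟩
    · rintro (h' | rfl)
      exacts [hS.lt_irrefl _ (hS.lt_trans h _ h'), hS.lt_irrefl _ h]
    · rcases h with h | rfl
      exacts [h, (h' (.inr rfl)).elim]
  le_antisymm a b := by
    rintro (h | rfl) (h' | h')
    exacts [(hS.lt_irrefl _ (hS.lt_trans h _ h')).elim, h'.symm, rfl, rfl]
  le_total a b := by
    rcases hS.lt_trichotomy a b with h | h | h
    exacts [.inr (.inl h), .inr (.inr h), .inl (.inl h)]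
  toDecidableLE := Classical.decRel _

end Raw

/-- The number part of a model of `RCA₀`: a discretely ordered commutative semiring. -/
class NumStructure (M : Type u) extends CommSemiring M, LinearOrder M, IsStrictOrderedRing M where
  lt_iff_exists' : ∀ x y : M, x < y ↔ ∃ c, y = x + c + 1

/-- The ordered semiring structure of the number part of a model of `RCA₀`. -/
noncomputable abbrev RCA0.numStructure {M : Type u} [Zero M] [One M] [Add M] [Mul M] [LT M]
    {S : Set (Set M)} (hS : RCA0 S) : NumStructure M :=
  letI := hS.commSemiring
  letI := hS.linearOrder
  have add_lt : ∀ a b c : M, a < b → c + a < c + b := fun a b c h => by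
    obtain ⟨d, rfl⟩ := (hS.lt_iff_exists _ _).1 h
    exact (hS.lt_iff_exists _ _).2 ⟨d, by ring⟩
  have mul_lt : ∀ a b c : M, 0 < c → a < b → c * a < c * b := fun a b c hc h => by
    obtain ⟨d, rfl⟩ := (hS.lt_iff_exists _ _).1 h
    obtain ⟨e, rfl⟩ := (hS.lt_iff_exists _ _).1 hc
    exact (hS.lt_iff_exists _ _).2 ⟨(e + 1) * d + e, by ring⟩
  have zero_lt_one : (0 : M) < 1 := (hS.lt_iff_exists _ _).2 ⟨0, by ring⟩
  { hS.commSemiring, hS.linearOrder with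
    lt_iff_exists' := hS.lt_iff_exists
    add_le_add_left := fun a b h c => by
      rcases h.lt_or_eq with h | rfl
      · rw [_root_.add_comm a, _root_.add_comm b]; exact (add_lt a b c h).le
      · rfl
    le_of_add_le_add_left := fun a b c h => by
      by_contra h'
      exact absurd (add_lt _ _ a (not_le.1 h')) (not_lt.2 h)
    zero_le_one := zero_lt_one.le
    exists_pair_ne := ⟨0, 1, zero_lt_one.ne⟩
    mul_lt_mul_of_pos_left := fun c hc a b h => mul_lt a b c hc h
    mul_lt_mul_of_pos_right := fun c hc a b h => by
      simp only [_root_.mul_comm _ c]; exact mul_lt a b c hc h }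

/-! ## Arithmetic -/

section Arithmetic

variable {M : Type u} [NumStructure M]

instance : CanonicallyOrderedAdd M where
  exists_add_of_le {a b} h := by
    rcases h.lt_or_eq with h | rfl
    · obtain ⟨c, rfl⟩ := (NumStructure.lt_iff_exists' _ _).1 h
      exact ⟨c + 1, by ring⟩
    · exact ⟨0, by simp⟩
  le_add_self a b := by
    rcases eq_or_ne b 0 with rfl | _
    · simp
    by_contra h
    obtain ⟨c, hc⟩ := (NumStructure.lt_iff_exists' _ _).1 (not_le.1 h)
    have : a + 0 = a + (b + c + 1) := by
      rw [add_zero]; conv_lhs => rw [hc]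
      ring
    have h0 : (0 : M) < b + c + 1 := (NumStructure.lt_iff_exists' _ _).2 ⟨b + c, by ring⟩
    exact h0.ne (add_left_cancel this)
  le_self_add a b := by
    by_contra h
    obtain ⟨c, hc⟩ := (NumStructure.lt_iff_exists' _ _).1 (not_le.1 h)
    have : a + 0 = a + (b + c + 1) := by
      rw [add_zero]; conv_lhs => rw [hc]
      ring
    have h0 : (0 : M) < b + c + 1 := (NumStructure.lt_iff_exists' _ _).2 ⟨b + c, by ring⟩
    exact h0.ne (add_left_cancel this)

theorem num_nonneg (a : M) : 0 ≤ a := zero_le (a := a)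

theorem exists_of_lt {a b : M} (h : a < b) : ∃ c, b = a + c + 1 :=
  (NumStructure.lt_iff_exists' _ _).1 h

theorem succ_le_iff {a b : M} : a + 1 ≤ b ↔ a < b := by
  refine ⟨fun h => (lt_add_one a).trans_le h, fun h => ?_⟩
  obtain ⟨c, rfl⟩ := exists_of_lt h
  rw [add_right_comm]
  exact le_self_add

theorem lt_succ_iff {a b : M} : a < b + 1 ↔ a ≤ b := by
  rw [← not_le, succ_le_iff, not_lt]

theorem eq_zero_or_succ (a : M) : a = 0 ∨ ∃ b, a = b + 1 := by
  rcases (num_nonneg a).eq_or_lt with h | h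
  · exact .inl h.symm
  · obtain ⟨c, h⟩ := exists_of_lt h
    exact .inr ⟨c, by rw [h, zero_add]⟩

theorem le_mul_self (a : M) : a ≤ a * a := by
  rcases eq_zero_or_succ a with rfl | ⟨b, rfl⟩
  · simp
  · exact le_mul_of_one_le_right (num_nonneg _) le_add_self

theorem le_pair_left (i j : M) : i ≤ pair i j := le_add_self

theorem le_pair_right (i j : M) : j ≤ pair i j :=
  (le_add_self.trans (le_mul_self _)).trans le_self_add

/-- The code of (i, j) lies in the interval from (i + j)² up to, but excluding, (i + j + 1)², and
these intervals are disjoint for different sums. Injectivity of pairing follows. -/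
theorem pair_lt_of_add_lt {i j k l : M} (h : i + j < k + l) : pair i j < pair k l := by
  have h1 : (i + j + 1) * (i + j + 1) ≤ (k + l) * (k + l) :=
    mul_self_le_mul_self (num_nonneg _) (succ_le_iff.2 h)
  refine lt_of_lt_of_le ?_ (h1.trans le_self_add)
  have : (i + j + 1) * (i + j + 1) = pair i j + ((i + j + j) + 1) := by unfold pair; ring
  rw [this]
  exact lt_add_of_pos_right _ (add_pos_of_nonneg_of_pos (num_nonneg _) one_pos)

theorem pair_inj {i j k l : M} : pair i j = pair k l ↔ i = k ∧ j = l := by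
  refine ⟨fun h => ?_, fun ⟨h, h'⟩ => by rw [h, h']⟩
  have hs : i + j = k + l := by
    rcases lt_trichotomy (i + j) (k + l) with h' | h' | h'
    exacts [absurd h (pair_lt_of_add_lt h').ne, h', absurd h (pair_lt_of_add_lt h').ne']
  have hi : i = k := by
    unfold pair at h
    rw [hs] at h
    exact add_left_cancel h
  exact ⟨hi, by rw [hi] at hs; exact add_left_cancel hs⟩

end Arithmetic

/-! ## Relations coded by sets of the model -/

/-- `(M, S)` is a model of `RCA₀`, as an instance. -/
class Model {M : Type u} [NumStructure M] (S : Set (Set M)) : Prop where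
  rca0 : RCA0 S

section Coding

variable {M : Type u} [NumStructure M] (S : Set (Set M))

/-- Types of tuples of numbers, coded by numbers through iterated pairing. -/
class Ctx (Γ : Type u) where
  enc : Γ → M
  range_mem : Set.range enc ∈ S

variable {S} in
/-- Comprehension for a bounded formula with at most three set parameters and one number
parameter, with variables numbered as indicated. -/
theorem Model.compr [hS : Model S] {θ : ArithFormula} (hθ : IsBounded θ) (c : M)
    {X Y Z : Set M} (hX : X ∈ S) (hY : Y ∈ S) (hZ : Z ∈ S)
    (P : M → Prop) (h : ∀ a b, Sat (fun | 0 => X | 1 => Y | _ => Z) θ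
      (Function.update (Function.update (assign c 0 0) 0 a) 1 b) ↔ P a) : {a | P a} ∈ S :=
  hS.rca0.bounded_comprehension hθ _ _ (by rintro (_ | _ | _) <;> assumption) P h

variable [hS : Model S]

open NumTerm

variable {S} in
theorem Model.univ_mem : Set.univ ∈ S := by
  obtain ⟨X, hX⟩ := hS.rca0.nonempty
  exact Model.compr (.eq zero zero) 0 hX hX hX (fun _ => True) (by simp [Sat])

instance : Ctx S M where
  enc := id
  range_mem := by rw [Set.range_id]; exact Model.univ_mem

/-- The bound of the quantifiers over components of pairs. -/
theorem IsBounded.exPair {x y z : ℕ} {θ : ArithFormula} (hxz : x ≠ z) (hyz : y ≠ z)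
    (hθ : IsBounded θ) :
    IsBounded (.ex x (.and (.lt (.var x) (.add (.var z) .one))
      (.ex y (.and (.lt (.var y) (.add (.var z) .one))
        (.and (.eq (.var z) (.pair (.var x) (.var y))) θ))))) :=
  .bex (by simp [vars, hxz]) (.bex (by simp [vars, hyz]) (.and (.eq _ _) hθ))

omit hS in
theorem exists_lt_succ_pair {z : M} {P : M → M → Prop} :
    (∃ x, x < z + 1 ∧ ∃ y, y < z + 1 ∧ z = pair x y ∧ P x y) ↔ ∃ x y, z = pair x y ∧ P x y := by
  constructor
  · rintro ⟨x, _, y, _, h⟩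
    exact ⟨x, y, h⟩
  · rintro ⟨x, y, rfl, h⟩
    exact ⟨x, lt_succ_iff.2 (le_pair_left _ _), y, lt_succ_iff.2 (le_pair_right _ _), rfl, h⟩

variable {S} in
/-- The pairs with first component in `X`. -/
theorem Model.left_mem {X : Set M} (hX : X ∈ S) : {z | ∃ x y, z = pair x y ∧ x ∈ X} ∈ S := by
  refine Model.compr (.exPair (x := 5) (y := 6) (z := 0) (by simp) (by simp)
    (.mem (var 5) 0)) 0 hX hX hX _ fun a b => ?_
  simp only [← exists_lt_succ_pair]
  simp [Sat, eval_pair, NumTerm.eval]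

instance {Γ : Type u} [Ctx S Γ] : Ctx S (Γ × M) where
  enc w := pair (Ctx.enc S w.1) w.2
  range_mem := by
    convert Model.left_mem (Ctx.range_mem (S := S) (Γ := Γ)) using 1
    ext z
    simp only [Set.mem_range, Prod.exists, Set.mem_ofPred_eq]
    constructor
    · rintro ⟨a, b, rfl⟩
      exact ⟨_, _, rfl, a, rfl⟩
    · rintro ⟨_, b, rfl, a, rfl⟩
      exact ⟨a, b, rfl⟩

/-- The relation `P` is coded by a set of the model. -/
class D0 {Γ : Type u} [Ctx S Γ] (P : Γ → Prop) : Prop where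
  exists_set : ∃ X ∈ S, ∀ γ, P γ ↔ Ctx.enc S γ ∈ X

/-- The graph of the function `f` is coded by a set of the model. -/
class DF {Γ : Type u} [Ctx S Γ] (f : Γ → M) : Prop where
  graph : D0 S (fun w : Γ × M => w.2 = f w.1)

/-- The set `X` belongs to the model. -/
class InModel (X : Set M) : Prop where
  mem : X ∈ S

variable {Γ : Type u} [Ctx S Γ]

omit [NumStructure M] hS in
theorem D0.congr {P Q : Γ → Prop} (hP : D0 S P) (h : ∀ γ, Q γ ↔ P γ) : D0 S Q :=
  ⟨let ⟨X, hX, hPX⟩ := hP; ⟨X, hX, fun γ => (h γ).trans (hPX γ)⟩⟩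

theorem D0.set_mem {P : M → Prop} (hP : D0 S P) : {a | P a} ∈ S := by
  obtain ⟨X, hX, h⟩ := hP
  convert hX
  ext a
  exact h a

instance D0.const (p : Prop) : D0 S (fun _ : Γ => p) := by
  by_cases hp : p
  · exact ⟨Set.univ, Model.univ_mem, by simp [hp]⟩
  · refine ⟨_, Model.compr (.neg (.eq zero zero)) 0 (X := Set.univ) (Y := Set.univ) (Z := Set.univ)
      Model.univ_mem Model.univ_mem Model.univ_mem (fun _ => False) (by simp [Sat]), ?_⟩
    simp [hp]

instance D0.not {P : Γ → Prop} [hP : D0 S P] : D0 S (fun γ => ¬ P γ) := by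
  obtain ⟨X, hX, h⟩ := hP
  refine ⟨_, Model.compr (.neg (.mem (var 0) 0)) 0 hX hX hX (fun a => a ∉ X) ?_, fun γ => ?_⟩
  · simp [Sat, NumTerm.eval]
  · rw [h]; rfl

instance D0.and {P Q : Γ → Prop} [hP : D0 S P] [hQ : D0 S Q] : D0 S (fun γ => P γ ∧ Q γ) := by
  obtain ⟨X, hX, h⟩ := hP
  obtain ⟨Y, hY, h'⟩ := hQ
  refine ⟨_, Model.compr (.and (.mem (var 0) 0) (.mem (var 0) 1)) 0 hX hY hX
    (fun a => a ∈ X ∧ a ∈ Y) ?_, fun γ => ?_⟩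
  · simp [Sat, NumTerm.eval]
  · rw [h, h']; rfl

instance D0.or {P Q : Γ → Prop} [D0 S P] [D0 S Q] : D0 S (fun γ => P γ ∨ Q γ) :=
  D0.congr S (P := fun γ => ¬ (¬ P γ ∧ ¬ Q γ)) inferInstance (fun γ => by tauto)

instance D0.imp {P Q : Γ → Prop} [D0 S P] [D0 S Q] : D0 S (fun γ => P γ → Q γ) :=
  D0.congr S (P := fun γ => ¬ (P γ ∧ ¬ Q γ)) inferInstance (fun γ => by tauto)

instance D0.iff {P Q : Γ → Prop} [D0 S P] [D0 S Q] : D0 S (fun γ => P γ ↔ Q γ) :=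
  D0.congr S (P := fun γ => (P γ → Q γ) ∧ (Q γ → P γ)) inferInstance (fun γ => by tauto)

/-- `Δ⁰₁` comprehension for relations. -/
theorem D0.delta1 {P : Γ → Prop} {Q Q' : Γ × M → Prop} (hQ : D0 S Q) (hQ' : D0 S Q')
    (h : ∀ γ, P γ ↔ ∃ y, Q (γ, y)) (h' : ∀ γ, P γ ↔ ∀ y, Q' (γ, y)) : D0 S P := by
  obtain ⟨X, hX, hQX⟩ := hQ
  obtain ⟨X', hX', hQX'⟩ := hQ'
  let V : ℕ → Set M := fun | 0 => X | 1 => X' | _ => Set.range (Ctx.enc S (Γ := Γ))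
  obtain ⟨Y, hY, hYs⟩ := hS.rca0.delta01_comprehension
    -- The two formulas must agree at every number, including those that code no tuple; the conjunct
    -- for set variable 2, the range of the coding, makes both false there.
    (.ex 1 (.and (.mem (var 0) 2) (.mem (.pair (var 0) (var 1)) 0)))
    (.all 1 (.and (.mem (var 0) 2) (.mem (.pair (var 0) (var 1)) 1)))
    ⟨1, _, .and (.mem _ _) (.mem _ _), rfl⟩ ⟨1, _, .and (.mem _ _) (.mem _ _), rfl⟩ 0
    (fun _ => 0) V (by rintro (_ | _ | _); exacts [hX, hX', Ctx.range_mem]) (fun a => by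
      simp only [Sat, NumTerm.eval_pair, NumTerm.eval, Function.update_apply, V]
      simp only [zero_ne_one, if_true, if_false]
      constructor
      · rintro ⟨y, ⟨γ, rfl⟩, hy⟩ y'
        exact ⟨⟨γ, rfl⟩, (hQX' (γ, y')).1 ((h' γ).1 ((h γ).2 ⟨y, (hQX (γ, y)).2 hy⟩) y')⟩
      · intro ha
        obtain ⟨γ, rfl⟩ := (ha 0).1
        obtain ⟨y, hy⟩ := (h γ).1 ((h' γ).2 fun y => (hQX' (γ, y)).2 (ha y).2)
        exact ⟨y, ⟨γ, rfl⟩, (hQX (γ, y)).1 hy⟩)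
  refine ⟨Y, hY, fun γ => ?_⟩
  rw [hYs, h]
  simp only [Sat, NumTerm.eval_pair, NumTerm.eval, Function.update_apply, V]
  simp only [zero_ne_one, if_true, if_false]
  exact exists_congr fun y => (hQX (γ, y)).trans ⟨fun h => ⟨⟨γ, rfl⟩, h⟩, fun h => h.2⟩

theorem D0.lift {P : Γ → Prop} (hP : D0 S P) : D0 S (fun w : Γ × M => P w.1) := by
  obtain ⟨X, hX, h⟩ := hP
  refine ⟨_, Model.left_mem hX, fun γ => ?_⟩
  rw [h]
  constructor
  · exact fun h => ⟨_, _, rfl, h⟩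
  · rintro ⟨x, y, h, h'⟩
    rwa [(pair_inj.1 h).1]


theorem D0.snd {P : M → Prop} (hP : D0 S P) : D0 S (fun w : Γ × M => P w.2) := by
  obtain ⟨X, hX, h⟩ := hP
  refine ⟨{z | ∃ x y, z = pair x y ∧ y ∈ X}, Model.compr (.exPair (x := 5) (y := 6) (z := 0)
    (by simp) (by simp) (.mem (var 6) 0)) 0 hX hX hX _ fun a b => ?_, fun γ => ?_⟩
  · simp only [← exists_lt_succ_pair]
    simp [Sat, eval_pair, NumTerm.eval]
  · rw [h]
    exact ⟨fun h => ⟨_, _, rfl, h⟩, fun ⟨x, y, h, h'⟩ => by rwa [← (pair_inj.1 h).2] at h'⟩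

instance DF.id : DF S (fun a : M => a) := by
  refine ⟨{z | ∃ x y, z = pair x y ∧ y = x}, Model.compr (.exPair (x := 5) (y := 6) (z := 0)
    (by simp) (by simp) (.eq (var 6) (var 5))) 0 Model.univ_mem Model.univ_mem Model.univ_mem _
      fun a b => ?_, fun γ => ?_⟩
  · simp only [← exists_lt_succ_pair]
    simp [Sat, eval_pair, NumTerm.eval]
  · exact ⟨fun h => ⟨_, _, rfl, h⟩, fun ⟨x, y, h, h'⟩ => by
      rwa [← (pair_inj.1 h).2, ← (pair_inj.1 h).1] at h'⟩

instance DF.const (c : M) : DF S (fun _ : Γ => c) := by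
  refine ⟨{z | ∃ x y, z = pair x y ∧ y = c}, Model.compr (.exPair (x := 5) (y := 6) (z := 0)
    (by simp) (by simp) (.eq (var 6) (var 2))) c Model.univ_mem Model.univ_mem Model.univ_mem _
      fun a b => ?_, fun γ => ?_⟩
  · simp only [← exists_lt_succ_pair]
    simp [Sat, eval_pair, NumTerm.eval, assign]
  · exact ⟨fun h => ⟨_, _, rfl, h⟩, fun ⟨x, y, h, h'⟩ => by
      rwa [← (pair_inj.1 h).2] at h'⟩

variable {S} in
/-- Comprehension for bounded relations between the components `x, a, b` of `pair (pair x a) b`,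
which are the variables `7, 8, 6`. -/
theorem Model.compr_triple {θ : ArithFormula} (hθ : IsBounded θ) {X : Set M} (hX : X ∈ S)
    (P : M → M → M → Prop) (h : ∀ v : ℕ → M, Sat (fun | 0 => X | 1 => X | _ => X) θ v ↔
      P (v 7) (v 8) (v 6)) : {z | ∃ y b, z = pair y b ∧ ∃ x a, y = pair x a ∧ P x a b} ∈ S := by
  refine Model.compr (.exPair (x := 5) (y := 6) (z := 0) (by simp) (by simp)
    (.exPair (x := 7) (y := 8) (z := 5) (by simp) (by simp) hθ)) 0 hX hX hX _ fun a b => ?_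
  simp only [← exists_lt_succ_pair]
  simp [Sat, eval_pair, NumTerm.eval, h]

theorem D0.of_triple {P : M → M → M → Prop}
    (hP : {z | ∃ y b, z = pair y b ∧ ∃ x a, y = pair x a ∧ P x a b} ∈ S) :
    D0 S (fun w : (Γ × M) × M => P (Ctx.enc S w.1.1) w.1.2 w.2) :=
  ⟨_, hP, fun γ => ⟨fun h => ⟨_, _, rfl, _, _, rfl, h⟩, fun ⟨y, b, h, x, a, h', h''⟩ => by
    obtain ⟨h1, h2⟩ := pair_inj.1 h
    rw [h'] at h1
    rwa [← h2, ← (pair_inj.1 h1).1, ← (pair_inj.1 h1).2] at h''⟩⟩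

theorem D0.eq_last : D0 S (fun w : (Γ × M) × M => w.2 = w.1.2) :=
  D0.of_triple S (P := fun _ a b => b = a) (Model.compr_triple (.eq (var 6) (var 8))
    Model.univ_mem _ fun v => by simp [Sat, NumTerm.eval])

theorem D0.lt_last : D0 S (fun w : (Γ × M) × M => w.1.2 < w.2) :=
  D0.of_triple S (P := fun _ a b => a < b) (Model.compr_triple (.lt (var 8) (var 6))
    Model.univ_mem _ fun v => by simp [Sat, NumTerm.eval])

instance DF.snd : DF S (fun w : Γ × M => w.2) := ⟨D0.eq_last S⟩

variable {S} in
theorem DF.lift {f : Γ → M} (hf : DF S f) : DF S (fun w : Γ × M => f w.1) := by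
  obtain ⟨X, hX, h⟩ := hf
  refine ⟨(D0.of_triple S (P := fun x _ b => pair x b ∈ X) (Model.compr_triple
    (.mem (.pair (var 7) (var 6)) 0) hX _ fun v => by
      simp [Sat, eval_pair, NumTerm.eval])).congr S fun w => h (w.1.1, w.2)⟩

variable {S} in
-- P at the value of f is Σ⁰₁ as "some y on the graph satisfies P" and Π⁰₁ as "every y on the graph
-- does".
theorem D0.subst {P : Γ × M → Prop} (hP : D0 S P) {f : Γ → M} (hf : DF S f) :
    D0 S (fun γ => P (γ, f γ)) := by
  have := hf.graph
  refine D0.delta1 S (Q := fun w => w.2 = f w.1 ∧ P w) (Q' := fun w => w.2 = f w.1 → P w)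
    inferInstance inferInstance (fun γ => by simp) (fun γ => by simp)

variable {S} in
theorem D0.comp {P : M → Prop} (hP : D0 S P) {f : Γ → M} (hf : DF S f) :
    D0 S (fun γ => P (f γ)) :=
  D0.subst (P := fun w => P w.2) (hP.snd S) hf

variable {S} in
theorem D0.comp_last {P : Γ → M → M → Prop} (hP : D0 S (fun w : (Γ × M) × M => P w.1.1 w.1.2 w.2))
    {f g : Γ → M} (hf : DF S f) (hg : DF S g) : D0 S (fun γ => P γ (f γ) (g γ)) :=
  (hP.subst (hg.lift)).subst hf

instance D0.eq {f g : Γ → M} [hf : DF S f] [hg : DF S g] : D0 S (fun γ => f γ = g γ) :=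
  D0.comp_last (P := fun _ a b => b = a) (D0.eq_last S) hg hf

instance D0.lt {f g : Γ → M} [hf : DF S f] [hg : DF S g] : D0 S (fun γ => f γ < g γ) :=
  D0.comp_last (P := fun _ a b => a < b) (D0.lt_last S) hf hg

instance D0.le {f g : Γ → M} [hf : DF S f] [hg : DF S g] : D0 S (fun γ => f γ ≤ g γ) :=
  D0.congr S (P := fun γ => ¬ g γ < f γ) inferInstance fun _ => not_lt.symm

instance D0.mem {f : Γ → M} {X : Set M} [hX : InModel S X] [hf : DF S f] :
    D0 S (fun γ => f γ ∈ X) :=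
  D0.comp (P := fun a => a ∈ X) ⟨X, hX.mem, fun _ => Iff.rfl⟩ hf

instance DF.add {f g : Γ → M} [hf : DF S f] [hg : DF S g] : DF S (fun γ => f γ + g γ) := by
  have h : D0 S (fun w : ((Γ × M) × M) × M => w.1.1.2 = w.1.2 + w.2) := by
    -- A ternary relation needs three components, so the head x of the triple is unpacked once more.
    refine (D0.of_triple S (P := fun x a b => ∃ x' < x + 1, ∃ c < x + 1, x = pair x' c ∧ c = a + b)
      (Model.compr_triple (.exPair (x := 9) (y := 10) (z := 7) (by simp) (by simp)
        (.eq (var 10) (NumTerm.add (var 8) (var 6)))) Model.univ_mem _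
        fun v => by simp [Sat, eval_pair, NumTerm.eval])).congr S fun w => ?_
    rw [exists_lt_succ_pair]
    exact ⟨fun h => ⟨_, _, rfl, h⟩, fun ⟨x, y, h, h'⟩ => by rwa [← (pair_inj.1 h).2] at h'⟩
  exact ⟨D0.comp_last (P := fun (v : Γ × M) a b => v.2 = a + b) h hf.lift hg.lift⟩

instance DF.mul {f g : Γ → M} [hf : DF S f] [hg : DF S g] : DF S (fun γ => f γ * g γ) := by
  have h : D0 S (fun w : ((Γ × M) × M) × M => w.1.1.2 = w.1.2 * w.2) := by
    refine (D0.of_triple S (P := fun x a b => ∃ x' < x + 1, ∃ c < x + 1, x = pair x' c ∧ c = a * b)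
      (Model.compr_triple (.exPair (x := 9) (y := 10) (z := 7) (by simp) (by simp)
        (.eq (var 10) (NumTerm.mul (var 8) (var 6)))) Model.univ_mem _
        fun v => by simp [Sat, eval_pair, NumTerm.eval])).congr S fun w => ?_
    rw [exists_lt_succ_pair]
    exact ⟨fun h => ⟨_, _, rfl, h⟩, fun ⟨x, y, h, h'⟩ => by rwa [← (pair_inj.1 h).2] at h'⟩
  exact ⟨D0.comp_last (P := fun (v : Γ × M) a b => v.2 = a * b) h hf.lift hg.lift⟩

/-- The `_eta` instances cover the eta-reduced forms that instance search may meet. -/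
instance DF.add_eta (a : M) : DF S (HAdd.hAdd a) := DF.add S (f := fun _ : M => a) (g := fun b => b)

instance DF.pair {f g : Γ → M} [DF S f] [DF S g] : DF S (fun γ => SOA.pair (f γ) (g γ)) :=
  inferInstanceAs (DF S (fun γ => (f γ + g γ) * (f γ + g γ) + f γ))

instance DF.pair_eta (a : M) : DF S (SOA.pair a) :=
  DF.pair S (f := fun _ : M => a) (g := fun b => b)

instance D0.lt_eta (a : M) : D0 S (LT.lt a) := D0.lt S (f := fun _ : M => a) (g := fun b => b)

instance D0.le_eta (a : M) : D0 S (LE.le a) := D0.le S (f := fun _ : M => a) (g := fun b => b)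

instance D0.mem_eta (X : Set M) [InModel S X] : D0 S (Membership.mem X) :=
  D0.mem S (f := fun a : M => a)

instance DF.ite {P : Γ → Prop} [∀ γ, Decidable (P γ)] {f g : Γ → M} [D0 S P] [DF S f] [DF S g] :
    DF S (fun γ => if P γ then f γ else g γ) := by
  have h1 : D0 S (fun w : Γ × M => P w.1) := D0.lift S inferInstance
  have h2 : DF S (fun w : Γ × M => f w.1) := DF.lift inferInstance
  have h3 : DF S (fun w : Γ × M => g w.1) := DF.lift inferInstance
  refine ⟨D0.congr S (P := fun w => (P w.1 ∧ w.2 = f w.1) ∨ (¬ P w.1 ∧ w.2 = g w.1))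
    inferInstance fun w => ?_⟩
  split_ifs with h <;> simp [h]

instance D0.ball {P : Γ → M → Prop} {f : Γ → M} [hP : D0 S (fun w : Γ × M => P w.1 w.2)]
    [hf : DF S f] : D0 S (fun γ => ∀ a, a < f γ → P γ a) := by
  obtain ⟨X, hX, h⟩ := hP
  refine D0.subst (P := fun w => ∀ a, a < w.2 → P w.1 a) ⟨{z | ∃ x b, z = SOA.pair x b ∧
    ∀ a, a < b → SOA.pair x a ∈ X}, Model.compr (.exPair (x := 5) (y := 6) (z := 0)
    (by simp) (by simp) (.ball (x := 7) (t := var 6) (by simp [vars])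
      (.mem (.pair (var 5) (var 7)) 0))) 0 hX hX hX _ fun a b => ?_, fun γ => ?_⟩ hf
  · simp only [← exists_lt_succ_pair]
    simp [Sat, eval_pair, NumTerm.eval]
  · constructor
    · exact fun h' => ⟨_, _, rfl, fun a ha => (h (γ.1, a)).1 (h' a ha)⟩
    · rintro ⟨x, b, h1, h2⟩ a ha
      obtain ⟨rfl, rfl⟩ := pair_inj.1 h1
      exact (h (γ.1, a)).2 (h2 a ha)

instance D0.ball_le {P : Γ → M → Prop} {f : Γ → M} [D0 S (fun w : Γ × M => P w.1 w.2)]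
    [DF S f] : D0 S (fun γ => ∀ a, a ≤ f γ → P γ a) :=
  D0.congr S (P := fun γ => ∀ a, a < f γ + 1 → P γ a) inferInstance
    fun γ => by simp only [lt_succ_iff]

instance D0.bex {P : Γ → M → Prop} {f : Γ → M} [D0 S (fun w : Γ × M => P w.1 w.2)]
    [DF S f] : D0 S (fun γ => ∃ a, a < f γ ∧ P γ a) :=
  D0.congr S (P := fun γ => ¬ ∀ a, a < f γ → ¬ P γ a) inferInstance fun γ => by simp

instance D0.bex_le {P : Γ → M → Prop} {f : Γ → M} [D0 S (fun w : Γ × M => P w.1 w.2)]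
    [DF S f] : D0 S (fun γ => ∃ a, a ≤ f γ ∧ P γ a) :=
  D0.congr S (P := fun γ => ∃ a, a < f γ + 1 ∧ P γ a) inferInstance
    fun γ => by simp only [lt_succ_iff]

section Variables

instance DF.var1 : DF S (fun w : M × M => w.1) := (DF.id S).lift
instance DF.var2 : DF S (fun w : (M × M) × M => w.1.1) := (DF.var1 S).lift
instance DF.var3 : DF S (fun w : ((M × M) × M) × M => w.1.1.1) := (DF.var2 S).lift
instance DF.var4 : DF S (fun w : (((M × M) × M) × M) × M => w.1.1.1.1) := (DF.var3 S).lift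
instance DF.var5 : DF S (fun w : ((((M × M) × M) × M) × M) × M => w.1.1.1.1.1) := (DF.var4 S).lift
instance DF.snd1 : DF S (fun w : (Γ × M) × M => w.1.2) := (DF.snd S).lift
instance DF.snd2 : DF S (fun w : ((Γ × M) × M) × M => w.1.1.2) := (DF.snd1 S).lift
instance DF.snd3 : DF S (fun w : (((Γ × M) × M) × M) × M => w.1.1.1.2) := (DF.snd2 S).lift
end Variables

/-! ### Substitution into defined relations and functions -/

section Composition

variable {S}

theorem D0.comp2 {P : M → M → Prop} (hP : D0 S (fun w : M × M => P w.1 w.2)) (f g : Γ → M)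
    [DF S f] [DF S g] : D0 S (fun γ => P (f γ) (g γ)) := by
  obtain ⟨X, hX, h⟩ := hP
  have : InModel S X := ⟨hX⟩
  exact D0.congr S (P := fun γ => SOA.pair (f γ) (g γ) ∈ X) inferInstance fun γ => h (f γ, g γ)

theorem D0.comp3 {P : M → M → M → Prop} (hP : D0 S (fun w : (M × M) × M => P w.1.1 w.1.2 w.2))
    (f g h : Γ → M) [DF S f] [DF S g] [DF S h] : D0 S (fun γ => P (f γ) (g γ) (h γ)) := by
  obtain ⟨X, hX, hP⟩ := hP
  have : InModel S X := ⟨hX⟩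
  exact D0.congr S (P := fun γ => SOA.pair (SOA.pair (f γ) (g γ)) (h γ) ∈ X) inferInstance
    fun γ => hP ((f γ, g γ), h γ)

theorem D0.comp4 {P : M → M → M → M → Prop}
    (hP : D0 S (fun w : ((M × M) × M) × M => P w.1.1.1 w.1.1.2 w.1.2 w.2))
    (f g h k : Γ → M) [DF S f] [DF S g] [DF S h] [DF S k] :
    D0 S (fun γ => P (f γ) (g γ) (h γ) (k γ)) := by
  obtain ⟨X, hX, hP⟩ := hP
  have : InModel S X := ⟨hX⟩
  exact D0.congr S (P := fun γ => SOA.pair (SOA.pair (SOA.pair (f γ) (g γ)) (h γ)) (k γ) ∈ X)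
    inferInstance fun γ => hP (((f γ, g γ), h γ), k γ)

theorem DF.comp {F : M → M} (hF : DF S F) (f : Γ → M) [hf : DF S f] : DF S (fun γ => F (f γ)) :=
  have := hf.lift
  ⟨D0.comp2 (P := fun a b => b = F a) hF.graph (fun w : Γ × M => f w.1) (fun w => w.2)⟩

theorem DF.comp2 {F : M → M → M} (hF : DF S (fun w : M × M => F w.1 w.2)) (f g : Γ → M)
    [hf : DF S f] [hg : DF S g] : DF S (fun γ => F (f γ) (g γ)) :=
  have := hf.lift
  have := hg.lift
  ⟨D0.comp3 (P := fun a b c => c = F a b) hF.graph (fun w : Γ × M => f w.1) (fun w => g w.1)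
    (fun w => w.2)⟩

theorem DF.comp3 {F : M → M → M → M} (hF : DF S (fun w : (M × M) × M => F w.1.1 w.1.2 w.2))
    (f g h : Γ → M) [hf : DF S f] [hg : DF S g] [hh : DF S h] :
    DF S (fun γ => F (f γ) (g γ) (h γ)) :=
  have := hf.lift
  have := hg.lift
  have := hh.lift
  ⟨D0.comp4 (P := fun a b c d => d = F a b c) hF.graph (fun w : Γ × M => f w.1) (fun w => g w.1)
    (fun w => h w.1) (fun w => w.2)⟩

theorem DF.enc : DF S (Ctx.enc S (Γ := Γ)) := by
  obtain ⟨X, hX, h⟩ := (DF.id S).graph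
  exact ⟨X, hX, fun w => h (Ctx.enc S w.1, w.2)⟩

/-- A function with a `Σ⁰₁` graph is coded by a set of the model. -/
theorem DF.of_sigma1 {f : Γ → M} {Q : Γ → M → M → Prop}
    (hQ : D0 S (fun w : (Γ × M) × M => Q w.1.1 w.1.2 w.2))
    (h : ∀ γ y, y = f γ ↔ ∃ d, Q γ y d) : DF S f := by
  -- The Π⁰₁ form says that every witnessed value equals y. The last variable bounds both the
  -- witness and the value, so that one unbounded quantifier suffices.
  refine ⟨D0.delta1 S hQ (Q' := fun w => ∀ d, d ≤ w.2 → ∀ y, y ≤ w.2 → Q w.1.1 y d → y = w.1.2)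
    ?_ (fun w => h _ _) (fun w => ?_)⟩
  · obtain ⟨X, hX, hQ⟩ := hQ
    have : InModel S X := ⟨hX⟩
    have hr : ∀ γ y d, Q γ y d ↔ SOA.pair (SOA.pair (Ctx.enc S γ) y) d ∈ X :=
      fun γ y d => hQ ((γ, y), d)
    simp only [hr]
    have := (DF.enc (S := S) (Γ := Γ)).lift.lift.lift.lift
    infer_instance
  · constructor
    · intro hw e d _ y _ hy
      exact ((h _ _).2 ⟨d, hy⟩).trans hw.symm
    · intro hw
      obtain ⟨d, hd⟩ := (h w.1 _).1 rfl
      exact (hw (max d (f w.1)) d (le_max_left _ _) _ (le_max_right _ _) hd).symm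

end Composition

/-! ## Induction -/

section Induction

variable {S}

theorem Model.ind (P : M → Prop) (hP : D0 S P) (h0 : P 0) (hs : ∀ a, P a → P (a + 1)) (a : M) :
    P a :=
  hS.rca0.set_induction (hP.set_mem S) h0 hs a

theorem Model.ind_ex (P : M → M → Prop) (hP : D0 S (fun w : M × M => P w.1 w.2))
    (h0 : ∃ y, P 0 y) (hs : ∀ a y, P a y → ∃ y, P (a + 1) y) (a : M) : ∃ y, P a y := by
  obtain ⟨X, hX, h⟩ := hP
  have key : ∀ a, Sat (fun _ => X) (.ex 1 (.mem (.pair (var 0) (var 1)) 0))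
      (Function.update (fun _ => 0) 0 a) ↔ ∃ y, P a y := fun a => by
    simp only [Sat, NumTerm.eval_pair, NumTerm.eval, Function.update_apply]
    exact exists_congr fun y => (h (a, y)).symm
  have := hS.rca0.sigma01_induction _ ⟨1, _, .mem (.pair (var 0) (var 1)) 0, rfl⟩ 0 (fun _ => 0)
    (fun _ => X) (fun _ => hX)
  simp only [key] at this
  exact this h0 (fun a ⟨y, hy⟩ => hs a y hy) a

theorem Model.strong_ind (P : M → Prop) (hP : D0 S P) (hs : ∀ a, (∀ b, b < a → P b) → P a)
    (a : M) : P a := by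
  refine hs a (Model.ind (S := S) (fun a => ∀ b, b < a → P b) ?_ ?_ ?_ a)
  · have : D0 S (fun w : M × M => P w.2) := hP.snd S
    infer_instance
  · exact fun b hb => absurd hb not_lt_zero
  · intro a h b hb
    rcases (lt_succ_iff.1 hb).lt_or_eq with hb | rfl
    exacts [h b hb, hs b h]

theorem Model.exists_least (P : M → Prop) (hP : D0 S P) {a : M} (ha : P a) :
    ∃ b, P b ∧ ∀ c, c < b → ¬ P c := by
  by_contra! h
  refine Model.strong_ind (S := S) (fun a => ¬ P a) inferInstance (fun b hb hb' => ?_) a ha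
  obtain ⟨c, hc, hc'⟩ := h b hb'
  exact hb c hc hc'

/-- A bounded non-empty `Σ⁰₁` class of numbers has a greatest element. -/
theorem Model.exists_greatest (P : M → M → Prop) (hP : D0 S (fun w : M × M => P w.1 w.2)) (K : M)
    {a : M} (haK : a < K) (ha : ∃ y, P a y) :
    ∃ c, c < K ∧ (∃ y, P c y) ∧ ∀ d, c < d → d < K → ∀ y, ¬ P d y := by
  by_contra! h
  -- Without a greatest element, Σ⁰₁ induction on j finds elements c ≥ j below K for every j, which
  -- is absurd at j = K.
  obtain ⟨y, c, hc, hKc, _⟩ := Model.ind_ex (S := S) (fun j y => ∃ c, c < K ∧ j ≤ c ∧ P c y)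
    (by
      have := D0.comp2 hP (fun w : (M × M) × M => w.2) (fun w => w.1.2)
      infer_instance)
    (ha.imp fun y hy => ⟨a, haK, num_nonneg _, hy⟩)
    (fun j y ⟨c, hc, hj, hy⟩ => by
      obtain ⟨d, hcd, hd, z, hz⟩ := h c hc ⟨y, hy⟩
      exact ⟨z, d, hd, succ_le_iff.2 (hj.trans_lt hcd), hz⟩) K
  exact absurd hc hKc.not_gt

end Induction

end Coding

/-! ## Codes of finite sets -/

section Divisibility

variable {M : Type u} [NumStructure M]

theorem dvd_of_dvd_add {a b c : M} (ha : 0 < a) (hb : a ∣ b) (h : a ∣ b + c) : a ∣ c := by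
  obtain ⟨s, rfl⟩ := hb
  obtain ⟨t, ht⟩ := h
  have hst : s ≤ t := by
    by_contra hst
    exact absurd (le_self_add.trans ht.le) (not_le.2 (mul_lt_mul_of_pos_left (not_le.1 hst) ha))
  obtain ⟨r, rfl⟩ := exists_add_of_le hst
  refine ⟨r, ?_⟩
  rw [mul_add] at ht
  exact add_left_cancel ht

theorem modulus_pos (m l : M) : 0 < m * (l + 1) + 1 :=
  lt_succ_iff.2 (num_nonneg _)

/-- The modulus times y equals m y (l + 1) + y, so m cancels without any theory of greatest common
divisors. -/
theorem modulus_dvd_of_dvd_mul {m l y : M} (h : m * (l + 1) + 1 ∣ m * y) :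
    m * (l + 1) + 1 ∣ y :=
  dvd_of_dvd_add (modulus_pos m l) (h.mul_right (l + 1)) ⟨y, by ring⟩

/-- The moduli `m (l + 1) + 1` and `m (i + 1) + 1` are coprime if `m` is divisible by all small
positive numbers. -/
theorem modulus_dvd_of_dvd_modulus_mul {m k l i x : M} (hm : ∀ d, 0 < d → d ≤ k → d ∣ m)
    (hl : l < k) (hi : i < k) (hli : l ≠ i) (h : m * (l + 1) + 1 ∣ (m * (i + 1) + 1) * x) :
    m * (l + 1) + 1 ∣ x := by
  -- Here d is the distance between l and i, and the two moduli differ by m d. Cancelling m,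
  -- multiplying up from d to its multiple m, and cancelling m again leaves x.
  obtain ⟨d, hd0, hdk, hd⟩ : ∃ d, 0 < d ∧ d ≤ k ∧ m * (l + 1) + 1 ∣ m * (d * x) := by
    rcases lt_or_gt_of_ne hli with hli | hli
    · obtain ⟨c, rfl⟩ := exists_of_lt hli
      refine ⟨c + 1, lt_succ_iff.2 (num_nonneg _), le_trans ?_ hi.le, ?_⟩
      · rw [add_assoc]; exact le_add_self
      · refine dvd_of_dvd_add (modulus_pos m l) (Dvd.intro x rfl) ?_
        convert h using 1
        ring
    · obtain ⟨c, rfl⟩ := exists_of_lt hli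
      refine ⟨c + 1, lt_succ_iff.2 (num_nonneg _), le_trans ?_ hl.le, ?_⟩
      · rw [add_assoc]; exact le_add_self
      · exact dvd_of_dvd_add (modulus_pos m _) h ⟨x, by ring⟩
  obtain ⟨e, he⟩ := hm d hd0 hdk
  refine modulus_dvd_of_dvd_mul ?_
  have h2 := (modulus_dvd_of_dvd_mul hd).mul_left e
  convert h2 using 1
  rw [he]; ring

end Divisibility

/-! ### Membership in coded sets and coding of bounded sets -/

section Codes

variable {M : Type u} [NumStructure M]

/-- `z` is an element of the finite set with code `d`. -/
def Mem (d z : M) : Prop :=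
  ∃ k, k ≤ d ∧ ∃ m, m ≤ d ∧ ∃ n, n ≤ d ∧ d = pair k (pair m n) ∧ z < k ∧ m * (z + 1) + 1 ∣ n

theorem Mem.lt {d z : M} (h : Mem d z) : z < d := by
  obtain ⟨k, hk, m, _, n, _, _, hz, _⟩ := h
  exact hz.trans_le hk

theorem Mem.right_lt {d j y : M} (h : Mem d (pair j y)) : y < d :=
  (le_pair_right j y).trans_lt h.lt

theorem mem_pair {k m n z : M} :
    Mem (pair k (pair m n)) z ↔ z < k ∧ m * (z + 1) + 1 ∣ n := by
  constructor
  · rintro ⟨k', _, m', _, n', _, h, h'⟩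
    obtain ⟨rfl, h1⟩ := pair_inj.1 h
    obtain ⟨rfl, rfl⟩ := pair_inj.1 h1
    exact h'
  · exact fun h => ⟨k, le_pair_left _ _, m, (le_pair_left _ _).trans (le_pair_right _ _), n,
      (le_pair_right _ _).trans (le_pair_right _ _), rfl, h⟩

variable (S : Set (Set M)) [hS : Model S] {Γ : Type u} [Ctx S Γ]

instance D0.dvd {f g : Γ → M} [DF S f] [DF S g] : D0 S (fun γ => f γ ∣ g γ) := by
  refine D0.comp2 (P := fun a b => a ∣ b) (D0.congr S
    (P := fun w : M × M => ∃ q, q ≤ w.2 ∧ w.2 = w.1 * q) inferInstance fun w => ?_) f g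
  constructor
  · rintro ⟨q, hq⟩
    rcases (num_nonneg w.1).eq_or_lt with h | h
    · exact ⟨0, num_nonneg _, by rw [hq, ← h]; simp⟩
    · refine ⟨q, ?_, hq⟩
      rw [hq]
      exact le_mul_of_one_le_left (num_nonneg _) (by simpa using succ_le_iff.2 h)
  · exact fun ⟨q, _, hq⟩ => ⟨q, hq⟩

instance D0.mem_code {f g : Γ → M} [DF S f] [DF S g] : D0 S (fun γ => Mem (f γ) (g γ)) :=
  D0.comp2 (P := Mem) (by unfold Mem; infer_instance) f g

instance D0.mem_code_eta (d : M) : D0 S (Mem d) := D0.mem_code S (f := fun _ : M => d)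

variable {S}

theorem Model.exists_common_multiple (S : Set (Set M)) [Model S] (k : M) :
    ∃ m : M, 0 < m ∧ ∀ d, d ≤ k → 0 < d → d ∣ m := by
  refine Model.ind_ex (S := S) (fun k m => 0 < m ∧ ∀ d, d ≤ k → 0 < d → d ∣ m) inferInstance
    ⟨1, one_pos, fun d hd hd' => absurd hd hd'.not_ge⟩ (fun k m ⟨hm, h⟩ => ?_) k
  refine ⟨m * (k + 1), mul_pos hm (lt_succ_iff.2 (num_nonneg _)), fun d hd hd0 => ?_⟩
  rcases hd.lt_or_eq with hd | rfl
  · exact (h d (lt_succ_iff.1 hd) hd0).mul_right _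
  · exact Dvd.intro_left m rfl

/-- Bounded sets of the model are coded by numbers. -/
theorem Model.exists_code (P : M → Prop) (hP : D0 S P) (k : M) :
    ∃ d, ∀ z, Mem d z ↔ z < k ∧ P z := by
  obtain ⟨m, hm0, hm⟩ := Model.exists_common_multiple S k
  suffices h : ∃ n, ∀ i, i < k → (m * (i + 1) + 1 ∣ n ↔ P i ∧ i < k) by
    obtain ⟨n, hn⟩ := h
    refine ⟨pair k (pair m n), fun z => mem_pair.trans ?_⟩
    constructor
    · exact fun ⟨hz, h⟩ => ⟨hz, ((hn z hz).1 h).1⟩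
    · exact fun ⟨hz, h⟩ => ⟨hz, (hn z hz).2 ⟨h, hz⟩⟩
  -- The number n built here is the product of the moduli m (i + 1) + 1 over the i < j, i < k that
  -- satisfy P.
  refine Model.ind_ex (S := S) (fun j n => ∀ i, i < k → (m * (i + 1) + 1 ∣ n ↔ P i ∧ i < j))
    ?_ ⟨1, fun i _ => ?_⟩ (fun j n h => ?_) k
  · have := D0.comp hP (DF.snd S (Γ := M × M))
    infer_instance
  · simp only [not_lt_zero, and_false, iff_false]
    rintro ⟨q, hq⟩
    have h1 : 0 < m * (i + 1) * q := by
      refine mul_pos (mul_pos hm0 (lt_succ_iff.2 (num_nonneg _))) ?_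
      rcases (num_nonneg q).eq_or_lt with h | h
      · rw [← h] at hq; simp at hq
      · exact h
    have h2 : q ≤ 0 := by
      by_contra h2
      rw [not_le, ← succ_le_iff, zero_add] at h2
      have : 1 < (m * (i + 1) + 1) * q :=
        calc 1 ≤ q := h2
          _ < m * (i + 1) * q + q := lt_add_of_pos_left _ h1
          _ = _ := by ring
      exact this.ne hq
    rw [le_antisymm h2 (num_nonneg q)] at h1
    simp at h1
  · by_cases hj : P j ∧ j < k
    · refine ⟨n * (m * (j + 1) + 1), fun i hi => ?_⟩
      rcases eq_or_ne i j with rfl | hij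
      · simp only [dvd_mul_left, true_iff]
        exact ⟨hj.1, lt_add_one i⟩
      · rw [lt_succ_iff, le_iff_lt_or_eq, or_iff_left hij, ← h i hi]
        refine ⟨fun hd => ?_, fun hd => hd.mul_right _⟩
        rw [mul_comm n] at hd
        exact modulus_dvd_of_dvd_modulus_mul (fun d h0 hd => hm d hd h0) hi hj.2 hij hd
    · refine ⟨n, fun i hi => (h i hi).trans ?_⟩
      rw [lt_succ_iff, le_iff_lt_or_eq]
      constructor
      · exact fun h => ⟨h.1, .inl h.2⟩
      · rintro ⟨h1, h2 | rfl⟩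
        exacts [⟨h1, h2⟩, absurd ⟨h1, hi⟩ hj]

end Codes

/-! ## Primitive recursion -/

section PrimitiveRecursion

variable {M : Type u} [NumStructure M] {S : Set (Set M)} [hS : Model S]

/-- `d` codes (a set of pairs that includes) a computation of the function defined by recursion from
the initial value `a` and the step function `h`. -/
def IsComputation (a : M) (h : M → M → M) (i d : M) : Prop :=
  (∀ y, y < d → Mem d (pair 0 y) → y = a) ∧ ∀ j, j < i → ∀ y, y < d → Mem d (pair (j + 1) y) →
    ∃ y', y' < d ∧ Mem d (pair j y') ∧ y = h j y'

theorem IsComputation.unique {a : M} {h : M → M → M} {i i' d d' : M} (S : Set (Set M)) [Model S]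
    (H : IsComputation a h i d) (H' : IsComputation a h i' d') (j : M) : j ≤ i → j ≤ i' →
    ∀ y, y < d → ∀ y', y' < d' → Mem d (pair j y) → Mem d' (pair j y') → y = y' := by
  refine Model.ind (S := S) (fun j => j ≤ i → j ≤ i' →
    ∀ y, y < d → ∀ y', y' < d' → Mem d (pair j y) → Mem d' (pair j y') → y = y') inferInstance
    ?_ ?_ j
  · intro _ _ y hy y' hy' h1 h2
    rw [H.1 y hy h1, H'.1 y' hy' h2]
  · intro j ih hj hj' y hy y' hy' h1 h2
    obtain ⟨z, hz, hzd, rfl⟩ := H.2 j (succ_le_iff.1 hj) y hy h1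
    obtain ⟨z', hz', hzd', rfl⟩ := H'.2 j (succ_le_iff.1 hj') y' hy' h2
    rw [ih (succ_le_iff.1 hj).le (succ_le_iff.1 hj').le z hz z' hz' hzd hzd']

theorem IsComputation.extend {a : M} {h : M → M → M} {i d y : M} (S : Set (Set M)) [Model S]
    (H : IsComputation a h i d) (hy : Mem d (pair i y)) :
    ∃ d', IsComputation a h (i + 1) d' ∧ Mem d' (pair (i + 1) (h i y)) := by
  obtain ⟨d', hd'⟩ := Model.exists_code (S := S)
    -- Entries of d with index above i are unconstrained and could be wrong, so they are discarded
    -- before the new value is added.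
    (fun z => (Mem d z ∧ ∃ j, j ≤ i ∧ ∃ y, y ≤ z ∧ z = pair j y) ∨ z = pair (i + 1) (h i y))
    inferInstance (d + pair (i + 1) (h i y) + 1)
  have key : ∀ j z, Mem d' (pair j z) ↔ (Mem d (pair j z) ∧ j ≤ i) ∨ (j = i + 1 ∧ z = h i y) := by
    intro j z
    rw [hd', pair_inj]
    constructor
    · rintro ⟨_, ⟨h1, j', hj', z', _, he⟩ | h1⟩
      · rw [(pair_inj.1 he).1]
        rw [he] at h1
        exact .inl ⟨(pair_inj.1 he).2 ▸ (pair_inj.1 he).2.symm ▸ h1, hj'⟩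
      · exact .inr h1
    · rintro (⟨h1, hj⟩ | ⟨rfl, rfl⟩)
      · exact ⟨lt_succ_iff.2 (h1.lt.le.trans le_self_add),
          .inl ⟨h1, j, hj, z, le_pair_right _ _, rfl⟩⟩
      · exact ⟨lt_succ_iff.2 le_add_self, .inr ⟨rfl, rfl⟩⟩
  refine ⟨d', ⟨fun z _ hz => ?_, fun j hj z _ hz => ?_⟩, (key _ _).2 (.inr ⟨rfl, rfl⟩)⟩
  · rcases (key _ _).1 hz with ⟨hz, _⟩ | ⟨h0, _⟩
    · exact H.1 z hz.right_lt hz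
    · exact absurd h0 (lt_succ_iff.2 (num_nonneg i)).ne
  · rw [lt_succ_iff] at hj
    rcases (key _ _).1 hz with ⟨hz, hji⟩ | ⟨h1, rfl⟩
    · obtain ⟨w, hw, hwd, rfl⟩ := H.2 j (succ_le_iff.1 hji) z hz.right_lt hz
      have := (key j w).2 (.inl ⟨hwd, hj⟩)
      exact ⟨w, this.right_lt, this, rfl⟩
    · obtain rfl := add_right_cancel h1
      have := (key j y).2 (.inl ⟨hy, hj⟩)
      exact ⟨y, this.right_lt, this, rfl⟩

/-- Definition by primitive recursion with a parameter. -/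
theorem Model.exists_primrec (a : M → M) (h : M → M → M → M) (ha : DF S a)
    (hh : DF S (fun w : (M × M) × M => h w.1.1 w.1.2 w.2)) :
    ∃ g : M → M → M, DF S (fun w : M × M => g w.1 w.2) ∧ (∀ p, g p 0 = a p) ∧
      ∀ p i, g p (i + 1) = h p i (g p i) := by
  have i1 : ∀ {Γ : Type u} [Ctx S Γ] (f : Γ → M) [DF S f], DF S (fun γ => a (f γ)) := ha.comp
  have i2 : ∀ {Γ : Type u} [Ctx S Γ] (f f' f'' : Γ → M) [DF S f] [DF S f'] [DF S f''],
      DF S (fun γ => h (f γ) (f' γ) (f'' γ)) := hh.comp3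
  have i3 : D0 S (fun w : (M × M) × M => IsComputation (a w.1.1) (h w.1.1) w.1.2 w.2) := by
    unfold IsComputation; infer_instance
  have i4 : ∀ {Γ : Type u} [Ctx S Γ] (f f' f'' : Γ → M) [DF S f] [DF S f'] [DF S f''],
      D0 S (fun γ => IsComputation (a (f γ)) (h (f γ)) (f' γ) (f'' γ)) :=
    D0.comp3 (P := fun u v w => IsComputation (a u) (h u) v w) i3
  have ex : ∀ p i, ∃ d, IsComputation (a p) (h p) i d ∧ ∃ y, y < d ∧ Mem d (pair i y) := by
    intro p
    refine Model.ind_ex (S := S)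
      (fun i d => IsComputation (a p) (h p) i d ∧ ∃ y, y < d ∧ Mem d (pair i y)) inferInstance ?_ ?_
    · obtain ⟨d, hd⟩ := Model.exists_code (S := S) (fun z => z = pair 0 (a p)) inferInstance
        (pair 0 (a p) + 1)
      have := (hd (pair 0 (a p))).2 ⟨lt_add_one _, rfl⟩
      exact ⟨d, ⟨fun y _ hy => (pair_inj.1 ((hd _).1 hy).2).2, fun j hj => absurd hj not_lt_zero⟩,
        _, this.right_lt, this⟩
    · rintro i d ⟨hd, y, _, hy⟩
      obtain ⟨d', hd', hm⟩ := hd.extend S hy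
      exact ⟨d', hd', _, hm.right_lt, hm⟩
  choose d hd g _ hg using ex
  have huniq : ∀ p i y e, IsComputation (a p) (h p) i e → Mem e (pair i y) → y = g p i :=
    fun p i y e he hy => he.unique S (hd p i) i le_rfl le_rfl _ hy.right_lt _ (hg p i).right_lt hy
      (hg p i)
  refine ⟨g, ?_, fun p => ?_, fun p i => ?_⟩
  -- Although g comes from choice, its graph is Σ⁰₁: y is the value iff some computation contains
  -- it, by uniqueness.
  · refine DF.of_sigma1 (Q := fun w y e => IsComputation (a w.1) (h w.1) w.2 e ∧ Mem e (pair w.2 y))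
      inferInstance fun w y => ⟨?_, fun ⟨e, he, hy⟩ => huniq _ _ _ e he hy⟩
    rintro rfl
    exact ⟨_, hd _ _, hg _ _⟩
  · exact (hd p 0).1 _ (hg p 0).right_lt (hg p 0)
  · obtain ⟨d', hd', hm⟩ := (hd p i).extend S (hg p i)
    exact (huniq p (i + 1) _ d' hd' hm).symm

end PrimitiveRecursion

/-! ## Powers of two and binary expansions -/

section Binary

variable {M : Type u} [NumStructure M] (S : Set (Set M)) [hS : Model S]

theorem Model.exists_pow2 : ∃ g : M → M, DF S g ∧ g 0 = 1 ∧ ∀ i, g (i + 1) = (1 + 1) * g i := by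
  have h : DF S (fun w : (M × M) × M => (1 + 1) * w.2) := inferInstance
  obtain ⟨g, hg, h0, hs⟩ := Model.exists_primrec (S := S) (fun _ => 1) (fun _ _ y => (1 + 1) * y)
    inferInstance h
  exact ⟨g 0, DF.comp2 hg (fun _ : M => 0) (fun a => a), h0 0, hs 0⟩

/-- The function `e ↦ 2 ^ e` of the model. -/
noncomputable def pow2 : M → M := (Model.exists_pow2 S).choose

instance DF.pow2_eta : DF S (pow2 S) := (Model.exists_pow2 S).choose_spec.1

instance DF.pow2 {Γ : Type u} [Ctx S Γ] {f : Γ → M} [DF S f] : DF S (fun γ => pow2 S (f γ)) :=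
  (DF.pow2_eta S).comp f

theorem pow2_zero : pow2 S 0 = 1 := (Model.exists_pow2 S).choose_spec.2.1

theorem pow2_succ (e : M) : pow2 S (e + 1) = (1 + 1) * pow2 S e :=
  (Model.exists_pow2 S).choose_spec.2.2 e

theorem pow2_pos (e : M) : 0 < pow2 S e := by
  refine Model.ind (S := S) (fun e => 0 < pow2 S e) inferInstance ?_ (fun e h => ?_) e
  · rw [pow2_zero]; exact one_pos
  · rw [pow2_succ]; positivity

theorem lt_pow2 (e : M) : e < pow2 S e := by
  refine Model.ind (S := S) (fun e => e < pow2 S e) inferInstance ?_ (fun e h => ?_) e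
  · rw [pow2_zero]; exact one_pos
  · rw [pow2_succ, add_mul, one_mul]
    exact add_lt_add_of_lt_of_le h (by simpa using succ_le_iff.2 (pow2_pos S e))

theorem pow2_add (a b : M) : pow2 S (a + b) = pow2 S a * pow2 S b := by
  refine Model.ind (S := S) (fun b => pow2 S (a + b) = pow2 S a * pow2 S b) inferInstance
    ?_ (fun b h => ?_) b
  · rw [pow2_zero, add_zero, mul_one]
  · rw [← add_assoc, pow2_succ, pow2_succ, h]; ring

theorem pow2_add_succ (a b : M) : pow2 S (a + b + 1) = (1 + 1) * pow2 S b * pow2 S a := by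
  rw [pow2_succ, pow2_add]; ring

theorem pow2_le_pow2 {a b : M} (h : a ≤ b) : pow2 S a ≤ pow2 S b := by
  obtain ⟨c, rfl⟩ := exists_add_of_le h
  rw [pow2_add]
  exact le_mul_of_one_le_right (num_nonneg _) (by simpa using succ_le_iff.2 (pow2_pos S c))

theorem lt_of_pow2_lt {a b : M} (h : pow2 S a < pow2 S b) : a < b := by
  by_contra h'
  exact absurd (pow2_le_pow2 S (not_lt.1 h')) h.not_ge

/-- This removes the set quantifier from `IsPow2`, and with it from `HasExponent`, which thereby
becomes a relation coded in the model. The graph of `pow2` serves as the witness G. -/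
theorem isPow2_iff {e p : M} : IsPow2 S e p ↔ p = pow2 S e := by
  constructor
  · rintro ⟨G, hG, hF, h0, hs, he⟩
    have : InModel S G := ⟨hG⟩
    have key := Model.ind (S := S) (fun e => pair e (pow2 S e) ∈ G) inferInstance
      (by rw [pow2_zero]; exact h0) (fun e h => by rw [pow2_succ]; exact hs _ _ h) e
    exact (hF.2 e trivial).unique he key
  · rintro rfl
    have key : ∀ i y, (∃ x, x ≤ pair i y ∧ ∃ z, z ≤ pair i y ∧ pair i y = pair x z ∧
        z = pow2 S x) ↔ y = pow2 S i := by
      intro i y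
      constructor
      · rintro ⟨x, _, z, _, h, h'⟩
        rwa [(pair_inj.1 h).1, (pair_inj.1 h).2]
      · exact fun h => ⟨i, le_pair_left _ _, y, le_pair_right _ _, rfl, h⟩
    refine ⟨{w | ∃ x, x ≤ w ∧ ∃ z, z ≤ w ∧ w = pair x z ∧ z = pow2 S x},
      D0.set_mem S inferInstance, ⟨?_, fun x _ => ?_⟩, ?_, fun i y h => ?_, ?_⟩
    · rintro w ⟨x, _, z, _, h, _⟩
      exact ⟨x, trivial, z, trivial, h⟩
    · exact ⟨pow2 S x, (key _ _).2 rfl, fun y hy => (key _ _).1 hy⟩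
    · exact (key _ _).2 (pow2_zero S).symm
    · exact (key _ _).2 (by rw [pow2_succ, (key _ _).1 h])
    · exact (key _ _).2 rfl

theorem hasExponent_iff {n e : M} : HasExponent S n e ↔
    ∃ q r, r < pow2 S e ∧ n = ((1 + 1) * q + 1) * pow2 S e + r := by
  simp only [HasExponent, isPow2_iff]
  constructor
  · rintro ⟨_, q, r, rfl, h⟩
    exact ⟨q, r, h⟩
  · rintro ⟨q, r, h⟩
    exact ⟨_, q, r, rfl, h⟩

variable {S}

theorem HasExponent.pow2_le {n e : M} (h : HasExponent S n e) : pow2 S e ≤ n := by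
  obtain ⟨q, r, _, rfl⟩ := (hasExponent_iff S).1 h
  rw [add_mul, one_mul]
  exact le_add_self.trans le_self_add

theorem HasExponent.lt {n e : M} (h : HasExponent S n e) : e < n :=
  (lt_pow2 S e).trans_le h.pow2_le

theorem HasExponent.pos {n e : M} (h : HasExponent S n e) : 0 < n :=
  (num_nonneg e).trans_lt h.lt

theorem not_hasExponent_zero (e : M) : ¬ HasExponent S 0 e := fun h => h.pos.false

theorem not_hasExponent_of_lt {x k e : M} (hx : x < pow2 S k) (hk : k ≤ e) :
    ¬ HasExponent S x e :=
  fun h => absurd (hx.trans_le (pow2_le_pow2 S hk)) h.pow2_le.not_gt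

variable (S) in
instance D0.hasExponent {Γ : Type u} [Ctx S Γ] {f g : Γ → M} [DF S f] [DF S g] :
    D0 S (fun γ => HasExponent S (f γ) (g γ)) := by
  refine D0.comp2 (P := HasExponent S) (D0.congr S (P := fun w : M × M => ∃ q, q ≤ w.1 ∧ ∃ r,
    r < pow2 S w.2 ∧ w.1 = ((1 + 1) * q + 1) * pow2 S w.2 + r) inferInstance fun w => ?_) f g
  rw [hasExponent_iff]
  constructor
  · rintro ⟨q, r, hr, h⟩
    refine ⟨q, ?_, r, hr, h⟩
    rw [h]
    calc q ≤ ((1 + 1) * q + 1) := by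
            rw [add_mul, one_mul, add_assoc]; exact le_self_add
      _ ≤ ((1 + 1) * q + 1) * pow2 S w.2 :=
            le_mul_of_one_le_right (num_nonneg _) (by simpa using succ_le_iff.2 (pow2_pos S w.2))
      _ ≤ _ := le_self_add
  · exact fun ⟨q, _, r, h⟩ => ⟨q, r, h⟩

variable (S) in
instance D0.hasExponent_eta (n : M) : D0 S (HasExponent S n) :=
  D0.hasExponent S (f := fun _ : M => n)

omit hS in
theorem div_unique {a b p r s : M} (hr : r < p) (hs : s < p) (h : a * p + r = b * p + s) :
    a = b ∧ r = s := by
  have aux : ∀ {a b r s : M}, r < p → a * p + r = b * p + s → b ≤ a := by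
    intro a b r s hr h
    by_contra hab
    obtain ⟨c, rfl⟩ := exists_of_lt (not_le.1 hab)
    have : r = p + (c * p + s) := add_left_cancel (h.trans (by ring : _ = a * p + _))
    exact absurd (this ▸ le_self_add : p ≤ r) hr.not_ge
  have hab := le_antisymm (aux hs h.symm) (aux hr h)
  exact ⟨hab, by rw [hab] at h; exact add_left_cancel h⟩

theorem Model.exists_div (S : Set (Set M)) [Model S] (n : M) {p : M} (hp : 0 < p) : ∃ a r, r < p ∧ n = a * p + r := by
  obtain ⟨a, _, r, h⟩ := Model.ind (S := S)
    (fun n => ∃ a, a ≤ n ∧ ∃ r, r < p ∧ n = a * p + r) inferInstance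
    ⟨0, le_rfl, 0, hp, by simp⟩ (fun n ⟨a, ha, r, hr, h⟩ => by
      rcases (succ_le_iff.2 hr).lt_or_eq with hr' | hr'
      · exact ⟨a, ha.trans le_self_add, r + 1, hr', by rw [h, add_assoc]⟩
      · exact ⟨a + 1, by gcongr, 0, hp, by rw [h, add_assoc, hr']; ring⟩) n
  exact ⟨a, r, h⟩

theorem Model.even_or_odd (S : Set (Set M)) [Model S] (n : M) : (∃ m, n = (1 + 1) * m) ∨ ∃ m, n = (1 + 1) * m + 1 := by
  obtain ⟨a, r, hr, h⟩ := Model.exists_div S n (p := 1 + 1) (by positivity)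
  rcases (lt_succ_iff.1 hr).lt_or_eq with hr | rfl
  · have : r = 0 := by
      rw [← zero_add (1 : M), lt_succ_iff] at hr
      exact le_antisymm hr (num_nonneg r)
    exact .inl ⟨a, by rw [h, this]; ring⟩
  · exact .inr ⟨a, by rw [h]; ring⟩

omit hS in
theorem even_ne_odd (m n : M) : (1 + 1) * m ≠ (1 + 1) * n + 1 := by
  intro h
  have := (div_unique (a := m) (b := n) (p := 1 + 1) (r := 0) (s := 1) (by positivity)
    (lt_add_one 1) (by rw [add_zero, mul_comm, h, mul_comm])).2
  exact zero_ne_one this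

theorem hasExponent_iff_odd {a r e : M} (hr : r < pow2 S e) :
    HasExponent S (a * pow2 S e + r) e ↔ ∃ m, a = (1 + 1) * m + 1 := by
  rw [hasExponent_iff]
  constructor
  · rintro ⟨q, s, hs, h⟩
    exact ⟨q, (div_unique hr hs h).1⟩
  · rintro ⟨m, rfl⟩
    exact ⟨m, r, hr, rfl⟩

/-- Adding a multiple of 2 ^ k changes the quotient by 2 ^ e by an even number when e < k. -/
theorem hasExponent_add_high {x k e : M} (z : M) (h : e < k) :
    HasExponent S (x + z * pow2 S k) e ↔ HasExponent S x e := by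
  obtain ⟨c, rfl⟩ := exists_of_lt h
  obtain ⟨a, r, hr, rfl⟩ := Model.exists_div S x (pow2_pos S e)
  have : a * pow2 S e + r + z * pow2 S (e + c + 1) =
      (a + (1 + 1) * (z * pow2 S c)) * pow2 S e + r := by rw [pow2_add_succ]; ring
  rw [this, hasExponent_iff_odd hr, hasExponent_iff_odd hr]
  rcases Model.even_or_odd S a with ⟨m, rfl⟩ | ⟨m, rfl⟩
  · constructor
    · rintro ⟨n, h⟩
      rw [← mul_add] at h
      exact absurd h (even_ne_odd _ _)
    · rintro ⟨n, h⟩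
      exact absurd h (even_ne_odd _ _)
  · exact iff_of_true ⟨m + z * pow2 S c, by ring⟩ ⟨m, rfl⟩

theorem hasExponent_add_low {x k e : M} (z : M) (hx : x < pow2 S k) (h : k ≤ e) :
    HasExponent S (x + z * pow2 S k) e ↔ HasExponent S (z * pow2 S k) e := by
  obtain ⟨c, rfl⟩ := exists_add_of_le h
  obtain ⟨a, r, hr, rfl⟩ := Model.exists_div S z (pow2_pos S c)
  have h1 : r * pow2 S k + x < pow2 S (k + c) :=
    calc r * pow2 S k + x < r * pow2 S k + pow2 S k := by gcongr
      _ = (r + 1) * pow2 S k := by ring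
      _ ≤ pow2 S c * pow2 S k := by gcongr; exact succ_le_iff.2 hr
      _ = _ := by rw [pow2_add, mul_comm]
  have e1 : x + (a * pow2 S c + r) * pow2 S k = a * pow2 S (k + c) + (r * pow2 S k + x) := by
    rw [pow2_add]; ring
  have e2 : (a * pow2 S c + r) * pow2 S k = a * pow2 S (k + c) + r * pow2 S k := by
    rw [pow2_add]; ring
  rw [e1, e2, hasExponent_iff_odd h1, hasExponent_iff_odd (le_self_add.trans_lt h1)]

theorem pow2_dvd {n k : M} (h : ∀ e, e < k → ¬ HasExponent S n e) : pow2 S k ∣ n := by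
  refine Model.ind (S := S) (fun j => j ≤ k → pow2 S j ∣ n) inferInstance ?_ ?_ k le_rfl
  · intro _
    rw [pow2_zero]; exact one_dvd n
  · intro j ih hj
    obtain ⟨z, rfl⟩ := ih (succ_le_iff.1 hj).le
    rcases Model.even_or_odd S z with ⟨m, rfl⟩ | ⟨m, rfl⟩
    · exact ⟨m, by rw [pow2_succ]; ring⟩
    · exact absurd ((hasExponent_iff S).2 ⟨m, 0, pow2_pos S j, by ring⟩) (h j (succ_le_iff.1 hj))

theorem isGreatestExponent_of_bounds {n e : M} (h : pow2 S e ≤ n) (h' : n < pow2 S (e + 1)) :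
    IsGreatestExponent S n e := by
  obtain ⟨r, rfl⟩ := exists_add_of_le h
  rw [pow2_succ, add_mul, one_mul] at h'
  refine ⟨(hasExponent_iff S).2 ⟨0, r, lt_of_add_lt_add_left h', by ring⟩, fun d hd => ?_⟩
  rw [← le_iff_lt_or_eq, ← lt_succ_iff]
  refine lt_of_pow2_lt S (hd.pow2_le.trans_lt ?_)
  rwa [pow2_succ, add_mul, one_mul]

theorem exists_greatestExponent {n : M} (hn : 0 < n) :
    ∃ e, pow2 S e ≤ n ∧ n < pow2 S (e + 1) ∧ IsGreatestExponent S n e := by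
  obtain ⟨e, he, hmin⟩ := Model.exists_least (S := S) (fun e => n < pow2 S e) inferInstance
    (lt_pow2 S n)
  rcases eq_zero_or_succ e with rfl | ⟨e, rfl⟩
  · rw [pow2_zero] at he
    exact absurd (by simpa using succ_le_iff.2 hn) he.not_ge
  · have h := not_lt.1 (hmin e (lt_add_one e))
    exact ⟨e, h, he, isGreatestExponent_of_bounds h he⟩

theorem IsGreatestExponent.lt_pow2 {n e : M} (h : IsGreatestExponent S n e) :
    n < pow2 S (e + 1) := by
  obtain ⟨d, _, hd, hd'⟩ := exists_greatestExponent (S := S) h.1.pos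
  refine hd.trans_le (pow2_le_pow2 S ?_)
  gcongr
  exact (h.2 d hd'.1).elim LT.lt.le Eq.le

theorem exists_leastExponent {n : M} (hn : 0 < n) : ∃ e, IsLeastExponent S n e := by
  obtain ⟨d, _, _, hd⟩ := exists_greatestExponent (S := S) hn
  obtain ⟨e, he, hmin⟩ := Model.exists_least (S := S) (fun e => HasExponent S n e) inferInstance hd.1
  refine ⟨e, he, fun c hc => ?_⟩
  rw [← le_iff_lt_or_eq]
  exact not_lt.1 fun h => hmin c h hc

omit hS in
theorem IsLeastExponent.le {n e d : M} (h : IsLeastExponent S n e) (hd : HasExponent S n d) :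
    e ≤ d := le_iff_lt_or_eq.2 (h.2 d hd)

omit hS in
theorem IsGreatestExponent.le {n e d : M} (h : IsGreatestExponent S n e)
    (hd : HasExponent S n d) : d ≤ e := le_iff_lt_or_eq.2 (h.2 d hd)

theorem Before.exists_pow2 {m n : M} (h : Before S m n) :
    ∃ k z, m < pow2 S k ∧ n = z * pow2 S k ∧ 0 < n := by
  obtain ⟨a, b, ha, hb, hab⟩ := h
  obtain ⟨z, hz⟩ := pow2_dvd (S := S) (n := n) (k := b) fun e he h => (hb.le h).not_gt he
  exact ⟨b, z, ha.lt_pow2.trans_le (pow2_le_pow2 S (succ_le_iff.2 hab)), by rw [hz, mul_comm],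
    hb.1.pos⟩

theorem Before.lt {m n : M} (h : Before S m n) : m < n := by
  obtain ⟨k, z, hm, rfl, hn⟩ := h.exists_pow2
  refine hm.trans_le (le_mul_of_one_le_left (num_nonneg _) ?_)
  by_contra hz
  rw [not_le, ← zero_add (1 : M), lt_succ_iff] at hz
  rw [le_antisymm hz (num_nonneg z), zero_mul] at hn
  exact hn.false

theorem Before.isUnion {m n : M} (h : Before S m n) : IsUnion S m n (m + n) := by
  obtain ⟨k, z, hm, rfl, hn⟩ := h.exists_pow2
  intro e
  rcases lt_or_ge e k with hk | hk
  · rw [hasExponent_add_high z hk]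
    have := hasExponent_add_high (S := S) (x := 0) z hk
    rw [zero_add] at this
    rw [this, or_iff_left (not_hasExponent_zero e)]
  · rw [hasExponent_add_low z hm hk, or_iff_right (not_hasExponent_of_lt hm hk)]

/-- By induction on k, m and n leave the same remainder modulo 2 ^ k; at k = m + n both are smaller
than 2 ^ k. -/
theorem eq_of_hasExponent_iff {m n : M} (h : ∀ e, HasExponent S m e ↔ HasExponent S n e) :
    m = n := by
  have key := Model.ind (S := S) (fun k => ∃ r, r < pow2 S k ∧ ∃ a, a ≤ m ∧ ∃ b, b ≤ n ∧
    m = a * pow2 S k + r ∧ n = b * pow2 S k + r) inferInstance ?_ ?_ (m + n)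
  · obtain ⟨r, hr, a, _, b, _, hm, hn⟩ := key
    have hm' : m < pow2 S (m + n) := (lt_pow2 S m).trans_le (pow2_le_pow2 S le_self_add)
    have hn' : n < pow2 S (m + n) := (lt_pow2 S n).trans_le (pow2_le_pow2 S le_add_self)
    have h1 := (div_unique (a := 0) (b := a) hm' hr (by rw [zero_mul, zero_add]; exact hm)).2
    have h2 := (div_unique (a := 0) (b := b) hn' hr (by rw [zero_mul, zero_add]; exact hn)).2
    exact h1.trans h2.symm
  · refine ⟨0, pow2_pos S 0, m, le_rfl, n, le_rfl, ?_, ?_⟩ <;> rw [pow2_zero] <;> ring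
  · rintro k ⟨r, hr, a, ha, b, hb, hm, hn⟩
    have hk := h k
    rw [hm, hn, hasExponent_iff_odd hr, hasExponent_iff_odd hr] at hk
    have le2 : ∀ c : M, c ≤ (1 + 1) * c := fun c => by rw [add_mul, one_mul]; exact le_self_add
    rcases Model.even_or_odd S a with ⟨a', rfl⟩ | ⟨a', rfl⟩
    · rcases Model.even_or_odd S b with ⟨b', rfl⟩ | ⟨b', rfl⟩
      · refine ⟨r, hr.trans_le (pow2_le_pow2 S le_self_add), a', (le2 _).trans ha, b',
          (le2 _).trans hb, ?_, ?_⟩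
        · rw [pow2_succ, hm]; ring
        · rw [pow2_succ, hn]; ring
      · obtain ⟨c, hc⟩ := hk.2 ⟨_, rfl⟩
        exact absurd hc (even_ne_odd _ _)
    · rcases Model.even_or_odd S b with ⟨b', rfl⟩ | ⟨b', rfl⟩
      · obtain ⟨c, hc⟩ := hk.1 ⟨_, rfl⟩
        exact absurd hc (even_ne_odd _ _)
      · refine ⟨pow2 S k + r, ?_, a', ((le2 _).trans le_self_add).trans ha, b',
          ((le2 _).trans le_self_add).trans hb, ?_, ?_⟩
        · rw [pow2_succ, add_mul, one_mul]; gcongr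
        · rw [pow2_succ, hm]; ring
        · rw [pow2_succ, hn]; ring

theorem Before.eq_add_of_isUnion {m n u : M} (h : Before S m n) (hu : IsUnion S m n u) :
    u = m + n :=
  eq_of_hasExponent_iff fun e => (hu e).trans (h.isUnion e).symm

/-- Adding 2 ^ x where the digit is 0 gives no carry, so the quotient by a higher power 2 ^ y is
unchanged. -/
theorem exists_div_add_pow2 {c x y : M} (hx : ¬ HasExponent S c x) (hxy : x < y) :
    ∃ a r s, r < pow2 S y ∧ s < pow2 S y ∧ c = a * pow2 S y + r ∧
      c + pow2 S x = a * pow2 S y + s := by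
  obtain ⟨d, rfl⟩ := exists_of_lt hxy
  obtain ⟨b, r, hr, rfl⟩ := Model.exists_div S c (pow2_pos S x)
  rw [hasExponent_iff_odd hr] at hx
  obtain ⟨b, rfl⟩ := (Model.even_or_odd S b).resolve_right hx
  obtain ⟨a, t, ht, rfl⟩ := Model.exists_div S b (pow2_pos S d)
  have hs : (1 + 1) * t * pow2 S x + pow2 S x + r < pow2 S (x + d + 1) :=
    calc _ < (1 + 1) * t * pow2 S x + pow2 S x + pow2 S x := by gcongr
      _ = (1 + 1) * (t + 1) * pow2 S x := by ring
      _ ≤ (1 + 1) * pow2 S d * pow2 S x := by gcongr; exact succ_le_iff.2 ht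
      _ = _ := by rw [pow2_add_succ]
  refine ⟨a, (1 + 1) * t * pow2 S x + r, (1 + 1) * t * pow2 S x + pow2 S x + r,
    lt_of_le_of_lt ?_ hs, hs, ?_, ?_⟩
  · gcongr; exact le_self_add
  · rw [pow2_add_succ]; ring
  · rw [pow2_add_succ]; ring

theorem add_pow2_lt {c x k : M} (hx : ¬ HasExponent S c x) (hxk : x < k) (hc : c < pow2 S k) :
    c + pow2 S x < pow2 S k := by
  obtain ⟨a, r, s, hr, hs, h1, h2⟩ := exists_div_add_pow2 hx hxk
  have := (div_unique (a := 0) (b := a) hc hr (by rw [zero_mul, zero_add]; exact h1)).1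
  rwa [h2, ← this, zero_mul, zero_add]

theorem HasExponent.of_add_pow2 {c x y : M} (hx : ¬ HasExponent S c x)
    (h : HasExponent S (c + pow2 S x) y) : HasExponent S c y ∨ y = x := by
  rcases lt_trichotomy y x with hy | hy | hy
  · rw [← one_mul (pow2 S x), hasExponent_add_high 1 hy] at h
    exact .inl h
  · exact .inr hy
  · obtain ⟨a, r, s, hr, hs, h1, h2⟩ := exists_div_add_pow2 hx hy
    rw [h2, hasExponent_iff_odd hs] at h
    rw [h1, hasExponent_iff_odd hr]
    exact .inl h

end Binary

/-! ## Equivalence of the two principles -/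

section Equivalence

variable {M : Type u} [NumStructure M] {S : Set (Set M)} [hS : Model S]

omit hS in
theorem IsUnion.symm {m n u : M} (h : IsUnion S m n u) : IsUnion S n m u :=
  fun e => (h e).trans or_comm

theorem FUT22.ht22Apart (h : FUT22 S) : HT22Apart S := by
  intro F hF hFun
  have iF : InModel S F := ⟨hF⟩
  -- The colouring must also be defined at 0, the code of the empty set, which receives colour 0.
  obtain ⟨X, hX, hXfun, hXne, hXb, c, hc, hcol⟩ := h {w | w ∈ F ∨ w = pair 0 0}
    (D0.set_mem S inferInstance) (by
      refine ⟨?_, fun x _ => ?_⟩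
      · rintro z (hz | rfl)
        · obtain ⟨x, _, y, hy, rfl⟩ := hFun.1 z hz
          exact ⟨x, trivial, y, hy, rfl⟩
        · exact ⟨0, trivial, 0, show (0 : M) < 1 + 1 by positivity, rfl⟩
      · rcases (num_nonneg x).eq_or_lt with rfl | hx
        · refine ⟨0, .inr rfl, ?_⟩
          rintro y (hy | hy)
          · obtain ⟨x, hx, y, _, he⟩ := hFun.1 _ hy
            exact absurd hx ((pair_inj.1 he).1 ▸ lt_irrefl _)
          · exact (pair_inj.1 hy).2
        · obtain ⟨y, hy, hu⟩ := hFun.2 x hx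
          refine ⟨y, .inl hy, ?_⟩
          rintro z (hz | hz)
          · exact hu z hz
          · exact absurd (pair_inj.1 hz).1 hx.ne')
  have iX : InModel S X := ⟨hX⟩
  have hpos : ∀ i m, pair i m ∈ X → 0 < m := fun i m h => (hXne i m h).1.choose_spec.pos
  have hlt : ∀ i j m n, i < j → pair i m ∈ X → pair j n ∈ X → m < n :=
    fun i j m n hij hm hn => (hXb i j m n hij hm hn).lt
  have hle : ∀ i z, pair (i + 1) z ∈ X → i < z := by
    intro i
    suffices h : ∀ z, z ≤ i → pair (i + 1) z ∉ X from fun z hz => not_le.1 fun hzi => h z hzi hz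
    refine Model.ind (S := S) (fun i => ∀ z, z ≤ i → pair (i + 1) z ∉ X) (by infer_instance)
      (fun z hz hzX => absurd (hpos _ _ hzX) hz.not_gt) (fun i ih z hz hzX => ?_) i
    obtain ⟨m, hm, _⟩ := hXfun.2 (i + 1) (lt_succ_iff.2 (num_nonneg i))
    exact ih m (lt_succ_iff.1 ((hlt _ _ _ _ (lt_add_one _) hm hzX).trans_le hz)) hm
  have hmem : ∀ i m, pair i m ∈ X → 0 < i := fun i m h => by
    obtain ⟨x, hx, y, _, he⟩ := hXfun.1 _ h
    rwa [(pair_inj.1 he).1]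
  -- The range of an increasing sequence: the index is at most the value, so the quantifier is
  -- bounded and H is in the model.
  let H : Set M := {z | ∃ i, i ≤ z ∧ pair i z ∈ X}
  have hH : ∀ z, z ∈ H ↔ ∃ i, pair i z ∈ X := by
    refine fun z => ⟨fun ⟨i, _, h⟩ => ⟨i, h⟩, fun ⟨i, h⟩ => ⟨i, ?_, h⟩⟩
    rcases eq_zero_or_succ i with rfl | ⟨i, rfl⟩
    exacts [num_nonneg z, succ_le_iff.2 (hle i z h)]
  have hF' : ∀ z, 0 < z → pair z c ∈ ({w | w ∈ F ∨ w = pair 0 0} : Set M) → pair z c ∈ F := by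
    rintro z hz (h | h)
    exacts [h, absurd (pair_inj.1 h).1 hz.ne']
  refine ⟨H, D0.set_mem S inferInstance, fun z hz => ?_, fun a => ?_, fun x hx y hy hxy => ?_, c, hc,
    fun z hz => ?_⟩
  · obtain ⟨i, hi⟩ := (hH z).1 hz
    exact hpos i z hi
  · obtain ⟨m, hm, _⟩ := hXfun.2 (a + 1) (lt_succ_iff.2 (num_nonneg a))
    exact ⟨m, (hH m).2 ⟨_, hm⟩, hle a m hm⟩
  · obtain ⟨i, hi⟩ := (hH x).1 hx
    obtain ⟨j, hj⟩ := (hH y).1 hy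
    rcases lt_trichotomy i j with hij | rfl | hij
    · exact hXb i j x y hij hi hj
    · exact absurd ((hXfun.2 i (hmem _ _ hi)).unique hi hj) hxy.ne
    · exact absurd (hlt j i y x hij hj hi) hxy.not_gt
  · rcases hz with hz | ⟨x, hx, y, hy, hxy, rfl⟩
    · obtain ⟨i, hi⟩ := (hH z).1 hz
      exact hF' z (hpos i z hi) (hcol z (.inl ⟨i, hmem _ _ hi, hi⟩))
    · obtain ⟨i, hi⟩ := (hH x).1 hx
      obtain ⟨j, hj⟩ := (hH y).1 hy
      have hij : i ≠ j := by
        rintro rfl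
        exact hxy ((hXfun.2 i (hmem _ _ hi)).unique hi hj)
      refine hF' _ ((hpos i x hi).trans_le le_self_add) (hcol _ (.inr ⟨i, hmem _ _ hi, j,
        hmem _ _ hj, hij, x, y, hi, hj, ?_⟩))
      rcases lt_or_gt_of_ne hij with hij | hij
      · exact (hXb i j x y hij hi hj).isUnion
      · rw [add_comm]
        exact (hXb j i y x hij hj hi).isUnion.symm

/-- The increasing enumeration of an unbounded set from a given element on. -/
theorem Model.exists_enumeration {H : Set M} (hH : H ∈ S) (hinf : ∀ a, ∃ x ∈ H, a < x) {a : M}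
    (ha : a ∈ H) :
    ∃ g : M → M, DF S g ∧ g 0 = a ∧ (∀ i, g i ∈ H) ∧ ∀ i j, i < j → g i < g j := by
  have iH : InModel S H := ⟨hH⟩
  have ex : ∀ a, ∃ b, (a < b ∧ b ∈ H) ∧ ∀ c, c < b → ¬ (a < c ∧ c ∈ H) := fun a => by
    obtain ⟨x, hx, hax⟩ := hinf a
    exact Model.exists_least (S := S) (fun b => a < b ∧ b ∈ H) inferInstance ⟨hax, hx⟩
  choose next hnext hmin using ex
  have iN : DF S next := ⟨D0.congr S
    (P := fun w : M × M => (w.1 < w.2 ∧ w.2 ∈ H) ∧ ∀ c, c < w.2 → ¬ (w.1 < c ∧ c ∈ H))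
    inferInstance fun w => ⟨fun h => h ▸ ⟨hnext _, hmin _⟩, fun ⟨h, h'⟩ => by
      rcases lt_trichotomy w.2 (next w.1) with hw | hw | hw
      exacts [absurd h (hmin _ _ hw), hw, absurd (hnext _) (h' _ hw)]⟩⟩
  have iN' : DF S (fun w : (M × M) × M => next w.2) := iN.comp _
  obtain ⟨g, hg, h0, hs⟩ := Model.exists_primrec (S := S) (fun _ => a) (fun _ _ y => next y)
    inferInstance iN'
  have ig : DF S (g 0) := DF.comp2 hg (fun _ : M => 0) (fun a => a)
  refine ⟨g 0, ig, h0 0, fun i => ?_, fun i j => ?_⟩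
  · rcases eq_zero_or_succ i with rfl | ⟨i, rfl⟩
    · rwa [h0]
    · rw [hs]; exact (hnext _).2
  · refine Model.ind (S := S) (fun j => i < j → g 0 i < g 0 j) inferInstance
      (fun h => absurd h not_lt_zero) (fun j ih hj => ?_) j
    rw [hs]
    rcases (lt_succ_iff.1 hj).lt_or_eq with hj | rfl
    exacts [(ih hj).trans (hnext _).1, (hnext _).1]

theorem HT22Apart.fut22 (h : HT22Apart S) : FUT22 S := by
  intro F hF hFun
  have iF : InModel S F := ⟨hF⟩
  have hmemF : ∀ x y, pair x y ∈ {w | w ∈ F ∧ ∃ x, x ≤ w ∧ ∃ y, y ≤ w ∧ w = pair x y ∧ 0 < x} ↔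
      pair x y ∈ F ∧ 0 < x := by
    intro x y
    constructor
    · rintro ⟨h, x', _, y', _, he, hx⟩
      exact ⟨h, (pair_inj.1 he).1 ▸ hx⟩
    · exact fun ⟨h, hx⟩ => ⟨h, x, le_pair_left _ _, y, le_pair_right _ _, rfl, hx⟩
  obtain ⟨H, hH, hpos, hinf, hap, c, hc, hcol⟩ := h
    {w | w ∈ F ∧ ∃ x, x ≤ w ∧ ∃ y, y ≤ w ∧ w = pair x y ∧ 0 < x}
    (D0.set_mem S inferInstance) (by
      refine ⟨?_, fun x hx => ?_⟩
      · rintro z ⟨hz, x, _, y, _, rfl, hx⟩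
        obtain ⟨_, _, y', hy, he⟩ := hFun.1 _ hz
        exact ⟨x, hx, y, (pair_inj.1 he).2 ▸ hy, rfl⟩
      · obtain ⟨y, hy, hu⟩ := hFun.2 x trivial
        exact ⟨y, (hmemF x y).2 ⟨hy, hx⟩, fun z hz => hu z ((hmemF x z).1 hz).1⟩)
  obtain ⟨a, ha, _⟩ := hinf 0
  obtain ⟨g, ig, h0, hgH, hg⟩ := Model.exists_enumeration hH hinf ha
  -- The element g 0 is left out: the others have their least exponent above an exponent of g 0, so
  -- their sets contain only positive numbers.
  have hmemX : ∀ i m, pair i m ∈ {w | ∃ i, i ≤ w ∧ ∃ m, m ≤ w ∧ w = pair i m ∧ 0 < i ∧ m = g i} ↔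
      0 < i ∧ m = g i := by
    intro i m
    constructor
    · rintro ⟨i', _, m', _, he, h⟩
      rwa [(pair_inj.1 he).1, (pair_inj.1 he).2]
    · exact fun h => ⟨i, le_pair_left _ _, m, le_pair_right _ _, rfl, h⟩
  have iX : D0 S (fun w : M => ∃ i, i ≤ w ∧ ∃ m, m ≤ w ∧ w = pair i m ∧ 0 < i ∧ m = g i) := by
    have : DF S (fun w : (M × M) × M => g w.1.2) := ig.comp _
    infer_instance
  have hbefore : ∀ i j, i < j → Before S (g i) (g j) :=
    fun i j hij => hap _ (hgH i) _ (hgH j) (hg i j hij)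
  refine ⟨_, iX.set_mem S, ⟨?_, fun i hi => ⟨g i, (hmemX _ _).2 ⟨hi, rfl⟩,
    fun m hm => ((hmemX _ _).1 hm).2⟩⟩, fun i m hm => ?_, fun i j m n hij hm hn => ?_, c, hc,
    fun z hz => ?_⟩
  · rintro w ⟨i, _, m, _, rfl, hi, _⟩
    exact ⟨i, hi, m, trivial, rfl⟩
  · obtain ⟨hi, rfl⟩ := (hmemX i m).1 hm
    refine ⟨⟨_, (exists_leastExponent (S := S) (hpos (hgH i))).choose_spec.1⟩, fun e he => ?_⟩
    obtain ⟨b, d, _, hd, hbd⟩ := hbefore 0 i hi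
    exact (num_nonneg b).trans_lt (hbd.trans_le (hd.le he))
  · obtain ⟨_, rfl⟩ := (hmemX i m).1 hm
    obtain ⟨_, rfl⟩ := (hmemX j n).1 hn
    exact hbefore i j hij
  · rcases hz with ⟨i, _, hz⟩ | ⟨i, _, j, _, hij, m, n, hm, hn, hu⟩
    · obtain ⟨_, rfl⟩ := (hmemX i z).1 hz
      exact ((hmemF _ _).1 (hcol _ (.inl (hgH i)))).1
    · obtain ⟨_, rfl⟩ := (hmemX i m).1 hm
      obtain ⟨_, rfl⟩ := (hmemX j n).1 hn
      refine ((hmemF _ _).1 (hcol z (.inr ⟨_, hgH i, _, hgH j, ?_⟩))).1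
      rcases lt_or_gt_of_ne hij with hij | hij
      · exact ⟨(hg i j hij).ne, (hbefore i j hij).eq_add_of_isUnion hu⟩
      · exact ⟨(hg j i hij).ne', ((hbefore j i hij).eq_add_of_isUnion hu.symm).trans
          (add_comm _ _)⟩

end Equivalence

/-! ## Arithmetical comprehension -/

section ArithmeticalComprehension

variable {M : Type u} [NumStructure M] {S : Set (Set M)} [hS : Model S]

/-- Strong `Σ⁰₁` bounding. -/
theorem Model.strong_bounding {T : M → M → Prop} (hT : D0 S (fun w : M × M => T w.1 w.2))
    (hu : ∀ x s s', T x s → T x s' → s = s') (k : M) :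
    ∃ l, ∀ x, x < k → ∀ s, T x s → s < l := by
  have iT : ∀ {Γ : Type u} [Ctx S Γ] (f g : Γ → M) [DF S f] [DF S g],
      D0 S (fun γ => T (f γ) (g γ)) := hT.comp2
  -- Take the greatest c < 2 ^ k all of whose exponents are enumerated, with a common bound l on the
  -- stages. An enumerated x < k missing from c could be added, giving the larger number c + 2 ^ x.
  obtain ⟨c, hc, ⟨l, hl⟩, hmax⟩ := Model.exists_greatest (S := S)
    (fun c l => ∀ x, x < k → HasExponent S c x → ∃ s, s < l ∧ T x s) (by infer_instance)
    (pow2 S k) (pow2_pos S k) ⟨0, fun x _ h => absurd h (not_hasExponent_zero x)⟩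
  refine ⟨l, fun x hx s hs => ?_⟩
  by_cases hcx : HasExponent S c x
  · obtain ⟨s', hs', hT'⟩ := hl x hx hcx
    rwa [hu x s s' hs hT']
  · refine absurd (fun y hy hcy => ?_) (hmax (c + pow2 S x) (lt_add_of_pos_right _ (pow2_pos S x))
      (add_pow2_lt hcx hx hc) (max l (s + 1)))
    rcases hcy.of_add_pow2 hcx with hcy | rfl
    · obtain ⟨s', hs', hT'⟩ := hl y hy hcy
      exact ⟨s', hs'.trans_le (le_max_left _ _), hT'⟩
    · exact ⟨s, (lt_add_one s).trans_le (le_max_right _ _), hs⟩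

/-- `a` and the next exponent `b` of `n` form an important gap: some number below the least exponent
of `n` is enumerated by `T` at a stage between `a` and `b`. -/
def Gap (S : Set (Set M)) (T : M → M → Prop) (n a : M) : Prop :=
  HasExponent S n a ∧ ∃ b, b < n ∧ a < b ∧ HasExponent S n b ∧
    (∀ e, e < b → a < e → ¬ HasExponent S n e) ∧
    ∃ s, s < b ∧ a ≤ s ∧ ∃ x, x < n ∧ (∀ e, e ≤ x → ¬ HasExponent S n e) ∧ T x s

/-! ### Important gaps of a sum n + m with u = μ(n) and l = λ(m) -/

section GapsOfSums

variable {T : M → M → Prop} {n m u l : M}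

/-- Up to u the exponents of n + m and n coincide. As u is itself an exponent, the next exponent
after a is at most u and the enumerated x is below u, so nothing beyond u matters. -/
theorem gap_add_iff (hb : Before S n m) (hun : IsGreatestExponent S n u)
    (hlm : IsLeastExponent S m l) (hul : u < l) {a : M} (ha : a < u) :
    Gap S T (n + m) a ↔ Gap S T n a := by
  have hN := hb.isUnion
  have low : ∀ e, e ≤ u → (HasExponent S (n + m) e ↔ HasExponent S n e) := fun e he =>
    (hN e).trans (or_iff_left fun h => (hlm.le h).not_gt (he.trans_lt hul))
  have hlow : ∀ e, e ≤ u → e < n := fun e he => he.trans_lt hun.1.lt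
  constructor
  · rintro ⟨h1, b, _, hab, h2, h3, s, hsb, has, x, _, hx, hT⟩
    have hbu : b ≤ u := not_lt.1 fun h => h3 u h ha ((low u le_rfl).2 hun.1)
    have hxu : x < u := not_le.1 fun h => hx u h ((low u le_rfl).2 hun.1)
    exact ⟨(low a ha.le).1 h1, b, hlow b hbu, hab, (low b hbu).1 h2,
      fun e he hae h => h3 e he hae ((low e (he.le.trans hbu)).2 h), s, hsb, has, x, hlow x hxu.le,
      fun e he h => hx e he ((low e (he.trans hxu.le)).2 h), hT⟩
  · rintro ⟨h1, b, _, hab, h2, h3, s, hsb, has, x, _, hx, hT⟩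
    have hbu : b ≤ u := hun.le h2
    have hxu : x < u := not_le.1 fun h => hx u h hun.1
    exact ⟨(low a ha.le).2 h1, b, (hlow b hbu).trans_le le_self_add, hab, (low b hbu).2 h2,
      fun e he hae h => h3 e he hae ((low e (he.le.trans hbu)).1 h), s, hsb, has, x,
      (hlow x hxu.le).trans_le le_self_add,
      fun e he h => hx e he ((low e (he.trans hxu.le)).1 h), hT⟩

theorem gap_add_self (hb : Before S n m) (hun : IsGreatestExponent S n u)
    (hlm : IsLeastExponent S m l) (hul : u < l) {x s : M} (hx : ∀ e, e ≤ x → ¬ HasExponent S n e)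
    (hT : T x s) (hus : u ≤ s) (hsl : s < l) : Gap S T (n + m) u := by
  have hN := hb.isUnion
  have hxu : x < u := not_le.1 fun h => hx u h hun.1
  refine ⟨(hN u).2 (.inl hun.1), l, hlm.1.lt.trans_le le_add_self, hul, (hN l).2 (.inr hlm.1),
    fun e he hue h => ?_, s, hsl, hus, x, (hxu.trans hun.1.lt).trans_le le_self_add,
    fun e he h => ?_, hT⟩
  · rcases (hN e).1 h with h | h
    exacts [(hun.le h).not_gt hue, (hlm.le h).not_gt he]
  · rcases (hN e).1 h with h | h
    exacts [hx e he h, (hlm.le h).not_gt ((he.trans_lt hxu).trans hul)]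

omit hS in
theorem not_gap_of_le (hun : IsGreatestExponent S n u) {a : M} (ha : u ≤ a) : ¬ Gap S T n a := by
  rintro ⟨_, b, _, hab, h, _⟩
  exact (hun.le h).not_gt (ha.trans_lt hab)

/-- An exponent of n + m above u belongs to m, hence is at least l, whereas the numbers below the
least exponent of n + m are enumerated before l. -/
theorem not_gap_add (hb : Before S n m) (hun : IsGreatestExponent S n u)
    (hlm : IsLeastExponent S m l) (hT : ∀ x, x < u → ∀ s, T x s → s < l) {a : M} (ha : u < a) :
    ¬ Gap S T (n + m) a := by
  have hN := hb.isUnion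
  rintro ⟨h1, b, _, _, _, _, s, _, has, x, _, hx, hTx⟩
  have hxu : x < u := not_le.1 fun h => hx u h ((hN u).2 (.inl hun.1))
  rcases (hN a).1 h1 with h1 | h1
  · exact (hun.le h1).not_gt ha
  · exact (hT x hxu s hTx).not_ge ((hlm.le h1).trans has)

end GapsOfSums

open Classical in
/-- The number modulo `2` of elements of a family of sets below a number. -/
theorem Model.exists_parity {R : M → M → Prop} (hR : D0 S (fun w : M × M => R w.1 w.2)) :
    ∃ g : M → M → M, DF S (fun w : M × M => g w.1 w.2) ∧ (∀ n j, g n j < 1 + 1) ∧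
      (∀ n, g n 0 = 0) ∧ (∀ n j, ¬ R n j → g n (j + 1) = g n j) ∧
      (∀ n j, R n j → g n (j + 1) ≠ g n j) ∧
      ∀ n m j, (R n j ↔ R m j) → g n j = g m j → g n (j + 1) = g m (j + 1) := by
  have iR : ∀ {Γ : Type u} [Ctx S Γ] (f g : Γ → M) [DF S f] [DF S g],
      D0 S (fun γ => R (f γ) (g γ)) := hR.comp2
  have ih : DF S (fun w : (M × M) × M =>
    if R w.1.1 w.1.2 then (if w.2 = 0 then 1 else 0) else w.2) := inferInstance
  obtain ⟨g, hg, h0, hs⟩ := Model.exists_primrec (S := S) (fun _ => 0)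
    (fun n j y => if R n j then (if y = 0 then 1 else 0) else y) inferInstance ih
  refine ⟨g, hg, fun n j => ?_, h0, fun n j h => by rw [hs, if_neg h], fun n j h => ?_,
    fun n m j h h' => by simp only [hs, h, h']⟩
  · have : DF S (fun j => g n j) := DF.comp2 hg (fun _ : M => n) (fun j => j)
    refine Model.ind (S := S) (fun j => g n j < 1 + 1) (by infer_instance) ?_ (fun j ih => ?_) j
    · rw [h0]; positivity
    · rw [hs]
      split_ifs
      exacts [lt_add_one 1, by positivity, ih]
  · rw [hs, if_pos h]
    split_ifs with h'
    · rw [h']; exact one_ne_zero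
    · exact Ne.symm h'

theorem HT22Apart.exists_set_of_unique (h : HT22Apart S) {T : M → M → Prop}
    (hT : D0 S (fun w : M × M => T w.1 w.2)) (hu : ∀ x s s', T x s → T x s' → s = s') :
    D0 S (fun x => ∃ s, T x s) := by
  have iT : ∀ {Γ : Type u} [Ctx S Γ] (f g : Γ → M) [DF S f] [DF S g],
      D0 S (fun γ => T (f γ) (g γ)) := hT.comp2
  have iR : D0 S (fun w : M × M => Gap S T w.1 w.2) := by unfold Gap; infer_instance
  obtain ⟨g, hg, hg2, hg0, hgn, hgp, hgs⟩ := Model.exists_parity iR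
  have ig : ∀ {Γ : Type u} [Ctx S Γ] (f f' : Γ → M) [DF S f] [DF S f'],
    DF S (fun γ => g (f γ) (f' γ)) := hg.comp2
  have ig' : ∀ n, DF S (g n) := fun n => hg.comp2 (fun _ : M => n) (fun j => j)
  have hgc : ∀ n k, (∀ a, k ≤ a → ¬ Gap S T n a) → ∀ j, k ≤ j → g n j = g n k := by
    intro n k hk j
    refine Model.ind (S := S) (fun j => k ≤ j → g n j = g n k) (by infer_instance) (fun h0 => ?_)
      (fun j ih hj => ?_) j
    · rw [le_antisymm h0 (num_nonneg k)]
    · rcases hj.lt_or_eq with hj | rfl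
      · rw [lt_succ_iff] at hj
        rw [hgn n j (hk j hj), ih hj]
      · rfl
  have hmemF : ∀ x y, pair x y ∈
      {w | ∃ x, x ≤ w ∧ ∃ y, y ≤ w ∧ w = pair x y ∧ 0 < x ∧ y = g x x} ↔ 0 < x ∧ y = g x x := by
    intro x y
    constructor
    · rintro ⟨x', _, y', _, he, h⟩
      rwa [(pair_inj.1 he).1, (pair_inj.1 he).2]
    · exact fun h => ⟨x, le_pair_left _ _, y, le_pair_right _ _, rfl, h⟩
  obtain ⟨H, hH, hpos, hinf, hap, c, _, hcol⟩ := h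
    {w | ∃ x, x ≤ w ∧ ∃ y, y ≤ w ∧ w = pair x y ∧ 0 < x ∧ y = g x x}
    (D0.set_mem S (by infer_instance)) (by
      refine ⟨?_, fun x hx => ⟨g x x, (hmemF _ _).2 ⟨hx, rfl⟩, fun y hy => ((hmemF _ _).1 hy).2⟩⟩
      rintro z ⟨x, _, y, _, rfl, hx, rfl⟩
      exact ⟨x, hx, _, hg2 x x, rfl⟩)
  have iH : InModel S H := ⟨hH⟩
  -- Least exponents in H are unbounded: past an element above 2 ^ k, whose greatest exponent is at
  -- least k, apartness forces the next one to start above k.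
  have far : ∀ k, ∃ n ∈ H, ∀ e, e ≤ k → ¬ HasExponent S n e := by
    intro k
    obtain ⟨n, hn, hkn⟩ := hinf (pow2 S k)
    obtain ⟨m, hm, hnm⟩ := hinf n
    obtain ⟨a, b, ha, hb, hab⟩ := hap n hn m hm hnm
    refine ⟨m, hm, fun e he h => (hb.le h).not_gt (lt_of_le_of_lt he (lt_of_le_of_lt ?_ hab))⟩
    exact lt_succ_iff.1 (lt_of_pow2_lt S (hkn.trans ha.lt_pow2))
  have key : ∀ n ∈ H, ∀ x, (∀ e, e ≤ x → ¬ HasExponent S n e) → ∀ s, T x s → s < n := by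
    intro n hn x hx s hs
    by_contra hns
    obtain ⟨u, _, _, hun⟩ := exists_greatestExponent (S := S) (hpos hn)
    have hus : u ≤ s := hun.1.lt.le.trans (not_lt.1 hns)
    obtain ⟨l, hl⟩ := Model.strong_bounding hT hu u
    -- The three summands put λ(m) above the stages of numbers below u, put s inside the new gap,
    -- and ensure n < m so that apartness applies.
    obtain ⟨m, hm, hml⟩ := far (l + s + n)
    obtain ⟨k, hk⟩ := exists_leastExponent (S := S) (hpos hm)
    have hkl : l + s + n < k := not_le.1 fun h => hml k h hk.1
    have hsk : s < k := lt_of_le_of_lt (le_add_self.trans le_self_add) hkl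
    have hb : Before S n m := hap n hn m hm
      (lt_of_le_of_lt le_add_self (hkl.trans hk.1.lt))
    have huk : u < k := hus.trans_lt hsk
    have hlk : ∀ x, x < u → ∀ s, T x s → s < k := fun x hx s hs =>
      (hl x hx s hs).trans (lt_of_le_of_lt (le_self_add.trans le_self_add) hkl)
    have e1 : g (n + m) u = g n u := by
      refine Model.ind (S := S) (fun j => j ≤ u → g (n + m) j = g n j) (by infer_instance)
        (fun _ => by rw [hg0, hg0]) (fun j ih hj => ?_) u le_rfl
      have hju := succ_le_iff.1 hj
      exact hgs _ _ _ (gap_add_iff hb hun hk huk hju) (ih hju.le)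
    have e2 : g n n = g n u :=
      hgc n u (fun a ha => not_gap_of_le hun ha) n hun.1.lt.le
    have e3 : g (n + m) (n + m) = g (n + m) (u + 1) :=
      hgc _ _ (fun a ha => not_gap_add hb hun hk hlk (succ_le_iff.1 ha)) _
        ((succ_le_iff.2 hun.1.lt).trans le_self_add)
    have c1 : c = g n n := ((hmemF _ _).1 (hcol n (.inl hn))).2
    have c2 : c = g (n + m) (n + m) :=
      ((hmemF _ _).1 (hcol _ (.inr ⟨n, hn, m, hm, hb.lt.ne, rfl⟩))).2
    refine hgp (n + m) u (gap_add_self hb hun hk huk hx hs hus hsk) ?_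
    rw [← e3, ← c2, e1, ← e2, c1]
  -- By `key`, a stage bounded by n decides membership of x for every n ∈ H that starts above x, and
  -- `far` supplies such an n.
  refine D0.delta1 S
    (Q := fun w => w.2 ∈ H ∧ (∀ e, e ≤ w.1 → ¬ HasExponent S w.2 e) ∧ ∃ s, s < w.2 ∧ T w.1 s)
    (Q' := fun w => w.2 ∈ H → (∀ e, e ≤ w.1 → ¬ HasExponent S w.2 e) → ∃ s, s < w.2 ∧ T w.1 s)
    inferInstance inferInstance (fun x => ?_) (fun x => ?_)
  · constructor
    · rintro ⟨s, hs⟩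
      obtain ⟨n, hn, hx⟩ := far x
      exact ⟨n, hn, hx, s, key n hn x hx s hs, hs⟩
    · exact fun ⟨_, _, _, s, _, hs⟩ => ⟨s, hs⟩
  · constructor
    · exact fun ⟨s, hs⟩ n hn hx => ⟨s, key n hn x hx s hs, hs⟩
    · intro h
      obtain ⟨n, hn, hx⟩ := far x
      obtain ⟨s, _, hs⟩ := h n hn hx
      exact ⟨s, hs⟩

/-- `Σ⁰₁` comprehension. -/
theorem HT22Apart.sigma1 (h : HT22Apart S) {Γ : Type u} [Ctx S Γ] {P : Γ → M → Prop}
    (hP : D0 S (fun w : Γ × M => P w.1 w.2)) : D0 S (fun γ => ∃ y, P γ y) := by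
  obtain ⟨X, hX, hPX⟩ := hP
  have iX : InModel S X := ⟨hX⟩
  obtain ⟨Y, hY, hXY⟩ := h.exists_set_of_unique
    -- Passing to the least witness makes the stage unique.
    (T := fun x s => pair x s ∈ X ∧ ∀ t, t < s → pair x t ∉ X) inferInstance (by
      rintro x s t ⟨hs, hs'⟩ ⟨ht, ht'⟩
      rcases lt_trichotomy s t with hst | hst | hst
      exacts [absurd hs (ht' s hst), hst, absurd ht (hs' t hst)])
  refine ⟨Y, hY, fun γ => ?_⟩
  rw [show Ctx.enc S γ = Ctx.enc S (Ctx.enc S γ) from rfl, ← hXY]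
  constructor
  · rintro ⟨y, hy⟩
    exact Model.exists_least (S := S) (fun y => pair (Ctx.enc S γ) y ∈ X) inferInstance
      ((hPX (γ, y)).1 hy)
  · exact fun ⟨s, hs, _⟩ => ⟨s, (hPX (γ, s)).2 hs⟩

/-! ### Satisfaction of arithmetical formulas -/

instance NumTerm.df_eval {Γ : Type u} [Ctx S Γ] (ν : Γ → ℕ → M) [∀ i, DF S (fun γ => ν γ i)]
    (t : NumTerm) : DF S (fun γ => t.eval (ν γ)) := by
  induction t with
  | var x => simp only [NumTerm.eval]; infer_instance
  | zero => simp only [NumTerm.eval]; infer_instance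
  | one => simp only [NumTerm.eval]; infer_instance
  | add s t => simp only [NumTerm.eval]; infer_instance
  | mul s t => simp only [NumTerm.eval]; infer_instance

theorem df_update {Γ : Type u} [Ctx S Γ] (ν : Γ → ℕ → M) [hν : ∀ i, DF S (fun γ => ν γ i)]
    (x i : ℕ) : DF S (fun w : Γ × M => Function.update (ν w.1) x w.2 i) := by
  rcases eq_or_ne i x with rfl | hi
  · simp only [Function.update_self]; infer_instance
  · simp only [Function.update_of_ne hi]; exact (hν i).lift

/-- Each quantifier costs one use of Σ⁰₁ comprehension. The context is kept general because passing
under a quantifier adds a component to it. -/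
theorem HT22Apart.d0_sat (h : HT22Apart S) {V : ℕ → Set M} (hV : ∀ i, V i ∈ S) (φ : ArithFormula)
    {Γ : Type u} [Ctx S Γ] (ν : Γ → ℕ → M) [∀ i, DF S (fun γ => ν γ i)] :
    D0 S (fun γ => Sat V φ (ν γ)) := by
  have iV : ∀ i, InModel S (V i) := fun i => ⟨hV i⟩
  induction φ generalizing Γ with
  | eq s t => simp only [Sat]; infer_instance
  | lt s t => simp only [Sat]; infer_instance
  | mem t X => simp only [Sat]; infer_instance
  | neg φ ih => have := ih ν; simp only [Sat]; infer_instance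
  | and φ ψ ih ih' => have := ih ν; have := ih' ν; simp only [Sat]; infer_instance
  | or φ ψ ih ih' => have := ih ν; have := ih' ν; simp only [Sat]; infer_instance
  | imp φ ψ ih ih' => have := ih ν; have := ih' ν; simp only [Sat]; infer_instance
  | all x φ ih =>
    have := df_update (S := S) ν x
    have := ih (fun w : Γ × M => Function.update (ν w.1) x w.2)
    have := h.sigma1 (P := fun γ a => ¬ Sat V φ (Function.update (ν γ) x a)) inferInstance
    exact D0.congr S (D0.not S) fun γ => (not_exists_not).symm
  | ex x φ ih =>
    have := df_update (S := S) ν x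
    have := ih (fun w : Γ × M => Function.update (ν w.1) x w.2)
    exact h.sigma1 (P := fun γ a => Sat V φ (Function.update (ν γ) x a)) this

theorem HT22Apart.aca0 (h : HT22Apart S) : ACA0 S where
  nonempty := hS.rca0.nonempty
  basic := hS.rca0.basic
  induction X hX h0 hs := hS.rca0.set_induction (P := fun a => a ∈ X) hX h0 hs
  arithmetical_comprehension φ x v V hV := by
    have (i : ℕ) : DF S (fun a : M => Function.update v x a i) := by
      rcases eq_or_ne i x with rfl | hi
      · simp only [Function.update_self]; infer_instance
      · simp only [Function.update_of_ne hi]; infer_instance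
    exact ⟨_, (h.d0_sat hV φ (fun a : M => Function.update v x a)).set_mem S, fun _ => Iff.rfl⟩

end ArithmeticalComprehension

end SOA

theorem mainTheorem2 {M : Type u} [Zero M] [One M] [Add M] [Mul M] [LT M] (S : Set (Set M))
    (hS : SOA.RCA0 S) :
    (SOA.HT22Apart S ↔ SOA.FUT22 S) ∧
      (SOA.HT22Apart S → SOA.ACA0 S) ∧
      (SOA.FUT22 S → SOA.ACA0 S) := by
  -- Its operations and its order are the given ones by definition, so the results for
  -- `NumStructure` apply to the original signature.
  let _ := hS.numStructure
  have : SOA.Model S := ⟨hS⟩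
  exact ⟨⟨fun h => h.fut22, fun h => h.ht22Apart⟩, fun h => h.aca0, fun h => h.ht22Apart.aca0⟩
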